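/- Fix material constants $E>0$ and $-1<\nu<\tfrac12$. For $0<\varepsilon<R$ write $B_r=B_r(0)\subset\mathbb{R}^2$ and $A_{\varepsilon,R}=B_R\setminus\overline{B}_\varepsilon$, and let $$\mathscr{B}_{\varepsilon,R}=\{w\in H^2_0(B_R): w=a \text{ in } B_\varepsilon \text{ for some affine function } a\}.$$ For $s\in\mathbb{R}\setminus\{0\}$ let $\mathcal{J}^s_{0,\varepsilon}:\mathscr{B}_{\varepsilon,R}\to\mathbb{R}$ be the functional $$\mathcal{J}^s_{0,\varepsilon}(w)=\frac12\,\frac{1+\nu}{E}\int_{B_R}\big(|\nabla^2w|^2-\nu|\Delta w|^2\big)\,dx+\frac{s}{2\pi\varepsilon}\int_{\partial B_\varepsilon}\partial_{x_1}w\,d\mathcal{H}^1,$$ where $\partial_{x_1}w$ on $\partial B_\varepsilon$ is understood in the sense of traces. Put $$\alpha_\varepsilon=2\frac{R^2-\varepsilon^2}{R^2+\varepsilon^2}-2\log R^2,\qquad \beta_\varepsilon=2\varepsilon^2\frac{R^2}{R^2+\varepsilon^2},\qquad \gamma_\varepsilon=-\frac{2}{R^2+\varepsilon^2}.$$ Lemma.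 Let $s\in\mathbb{R}\setminus\{0\}$. For every $0<\varepsilon<R$ the function $$W^s_{0,\varepsilon}(x)=\begin{cases}\dfrac{s}{16\pi}\dfrac{E}{1-\nu^2}\Big(\alpha_\varepsilon+\beta_\varepsilon\dfrac1{|x|^2}+\gamma_\varepsilon|x|^2+2\log|x|^2\Big)x_1 & \text{if } x\in A_{\varepsilon,R},\\[2mm] \dfrac{s}{16\pi}\dfrac{E}{1-\nu^2}\Big(\alpha_\varepsilon+\dfrac{\beta_\varepsilon}{\varepsilon^2}+\varepsilon^2\gamma_\varepsilon+4\log\varepsilon\Big)x_1 & \text{if } x\in B_\varepsilon,\end{cases}$$ (extended continuously to $\partial B_\varepsilon$) belongs to $\mathscr{B}_{\varepsilon,R}$ and is the unique minimizer of $\mathcal{J}^s_{0,\varepsilon}$ in $\mathscr{B}_{\varepsilon,R}$. Moreover, $$\mathcal{J}^s_{0,\varepsilon}(W^s_{0,\varepsilon})=-\frac{s^2}{8\pi}\frac{E}{1-\nu^2}\Big(\log\frac R\varepsilon-\frac{R^2-\varepsilon^2}{R^2+\varepsilon^2}\Big).$$ -/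

import Mathlib

open MeasureTheory Filter Topology Metric
open scoped ContDiff

namespace AiryDipole

noncomputable section

/-- The Euclidean plane. The coordinates `x₁`, `x₂` of a point `x` are `x 0`, `x 1`. -/
abbrev Plane : Type := EuclideanSpace ℝ (Fin 2)

/-- The classical partial derivative in the `i`-th coordinate direction. -/
def partialDeriv (i : Fin 2) (φ : Plane → ℝ) (x : Plane) : ℝ :=
  fderiv ℝ φ x (EuclideanSpace.single i 1)

/-- `φ` belongs to `C_c^∞(Ω)`. -/
def IsTestFunction (Ω : Set Plane) (φ : Plane → ℝ) : Prop :=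
  ContDiff ℝ ∞ φ ∧ HasCompactSupport φ ∧ tsupport φ ⊆ Ω

/-- `g` is a weak `i`-th partial derivative of `u` on `Ω`. -/
def IsWeakPartial (Ω : Set Plane) (i : Fin 2) (u g : Plane → ℝ) : Prop :=
  LocallyIntegrableOn u Ω ∧ LocallyIntegrableOn g Ω ∧
    ∀ φ : Plane → ℝ, IsTestFunction Ω φ →
      ∫ x in Ω, u x * partialDeriv i φ x = -∫ x in Ω, g x * φ x

open scoped Classical in
/-- The weak `i`-th partial derivative of `u` on `Ω` (for open `Ω` it is unique up to a.e. equality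
on `Ω`; it is set to `0` if `u` has none). -/
def weakPartial (Ω : Set Plane) (i : Fin 2) (u : Plane → ℝ) : Plane → ℝ :=
  if h : ∃ g, IsWeakPartial Ω i u g then h.choose else 0

/-- The weak second derivative `∂ᵢ∂ⱼu` on `Ω`. -/
def weakHess (Ω : Set Plane) (i j : Fin 2) (u : Plane → ℝ) : Plane → ℝ :=
  weakPartial Ω i (weakPartial Ω j u)

/-- `u` belongs to the Sobolev space `H¹(Ω)`. -/
def MemH1 (Ω : Set Plane) (u : Plane → ℝ) : Prop :=
  MemLp u 2 (volume.restrict Ω) ∧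
    ∀ i, ∃ g, IsWeakPartial Ω i u g ∧ MemLp g 2 (volume.restrict Ω)

/-- `u` belongs to the Sobolev space `H²(Ω)`. -/
def MemH2 (Ω : Set Plane) (u : Plane → ℝ) : Prop :=
  MemLp u 2 (volume.restrict Ω) ∧ ∀ i, ∃ g, IsWeakPartial Ω i u g ∧ MemH1 Ω g

/-- The `H²(Ω)` norm (sum of the `L²` norms of all weak derivatives of order at most two) of a
function `u` in `H²(Ω)`. -/
def h2Norm (Ω : Set Plane) (u : Plane → ℝ) : ENNReal :=
  eLpNorm u 2 (volume.restrict Ω) + ∑ i, eLpNorm (weakPartial Ω i u) 2 (volume.restrict Ω) +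
    ∑ i, ∑ j, eLpNorm (weakHess Ω i j u) 2 (volume.restrict Ω)

/-- `u` belongs to `H²₀(Ω)`, the closure of `C_c^∞(Ω)` in `H²(Ω)`. -/
def MemH20 (Ω : Set Plane) (u : Plane → ℝ) : Prop :=
  MemH2 Ω u ∧ ∃ φ : ℕ → Plane → ℝ, (∀ n, IsTestFunction Ω (φ n)) ∧
    Tendsto (fun n => h2Norm Ω (fun x => u x - φ n x)) atTop (𝓝 0)

/-- The admissible class `𝓑_{ε,R}`: functions in `H²₀(B_R(0))` that agree with an affine
function in `B_ε(0)`. -/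
def MemB (ε R : ℝ) (w : Plane → ℝ) : Prop :=
  MemH20 (ball 0 R) w ∧ ∃ c₀ c₁ c₂ : ℝ,
    ∀ᵐ x : Plane ∂(volume.restrict (ball 0 ε)), w x = c₀ + c₁ * x 0 + c₂ * x 1

/-- The elastic energy
`𝓖(w; Ω) = (1/2) ((1+ν)/E) ∫_Ω (|∇²w|² - ν |Δw|²) dx` of an Airy function `w` in `H²(Ω)`. -/
def elasticEnergy (E ν : ℝ) (Ω : Set Plane) (w : Plane → ℝ) : ℝ :=
  1 / 2 * ((1 + ν) / E) *
    ∫ x in Ω, ((∑ i, ∑ j, (weakHess Ω i j w x) ^ 2) - ν * (∑ i, weakHess Ω i i w x) ^ 2)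

/-- The trace, on the boundary of a domain `U` with smooth boundary, of a Sobolev function `f` on
`U`: the value at a boundary point `x` is the limit of the means of `f` over `B_r(x) ∩ U` as
`r → 0⁺` (which exists for `ℋ¹`-almost every boundary point). If `f` is in `H¹` of a neighbourhood
of `∂U`, the traces from the two sides of `∂U` coincide. -/
def boundaryTrace (U : Set Plane) (f : Plane → ℝ) (x : Plane) : ℝ :=
  limUnder (𝓝[>] (0 : ℝ)) fun r : ℝ => ⨍ y in ball x r ∩ U, f y

/-- The functional
`𝓙ˢ_{0,ε}(w) = 𝓖(w; B_R(0)) + s/(2πε) ∫_{∂B_ε(0)} ∂_{x₁}w dℋ¹` on `𝓑_{ε,R}`, the boundary values of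
the weak derivative `∂_{x₁}w` on the circle being taken in the sense of traces. -/
def dipoleFunctional (E ν s ε R : ℝ) (w : Plane → ℝ) : ℝ :=
  elasticEnergy E ν (ball 0 R) w +
    s / (2 * Real.pi * ε) *
      ∫ x in sphere (0 : Plane) ε,
        boundaryTrace (ball 0 ε) (weakPartial (ball 0 R) 0 w) x ∂(μH[1])

def coeffAlpha (ε R : ℝ) : ℝ :=
  2 * ((R ^ 2 - ε ^ 2) / (R ^ 2 + ε ^ 2)) - 2 * Real.log (R ^ 2)

def coeffBeta (ε R : ℝ) : ℝ := 2 * ε ^ 2 * (R ^ 2 / (R ^ 2 + ε ^ 2))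

def coeffGamma (ε R : ℝ) : ℝ := -(2 / (R ^ 2 + ε ^ 2))

/-- The explicit function `Wˢ_{0,ε}`; only its values on `B_R(0)` matter. The two formulas agree on
the circle `∂B_ε(0)`. -/
def dipoleMinimizer (E ν s ε R : ℝ) (x : Plane) : ℝ :=
  if ‖x‖ < ε then
    s / (16 * Real.pi) * (E / (1 - ν ^ 2)) *
      (coeffAlpha ε R + coeffBeta ε R / ε ^ 2 + ε ^ 2 * coeffGamma ε R + 4 * Real.log ε) * x 0
  else
    s / (16 * Real.pi) * (E / (1 - ν ^ 2)) *
      (coeffAlpha ε R + coeffBeta ε R * (1 / ‖x‖ ^ 2) + coeffGamma ε R * ‖x‖ ^ 2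
        + 2 * Real.log (‖x‖ ^ 2)) * x 0

end

end AiryDipole

/-!
Write `J(w) = G(w) + s c₁(w)`, where `G` is the elastic energy and `c₁(w)` is the slope in direction
`x₁` of the affine function that `w` equals in the disc `B_ε`; the boundary term reduces to
`s c₁(w)` because the trace of a constant is that constant and a circle of radius `ε` has
`ℋ¹`-measure `2πε` (`dipoleFunctional_eq`, `hausdorffMeasure_sphere`). So `J` is a positive definite
quadratic form plus a linear functional, and everything follows by completing the square
(`dipoleFunctional_sub`) once the Euler–Lagrange equation
`((1 + ν) / E) ∫ (∇²W : ∇²w - ν ΔW Δw) = -s c₁(w)` is known for the explicit function `W`. Tested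
with `w = W` this equation gives the minimal value, `(s / 2) c₁(W)`.

The Euler–Lagrange equation (`integral_hessForm_dipoleMinimizer`) rests on two facts. On `H²₀` the
integral of `∇²W : ∇²w` is that of `ΔW Δw` (`HasWeakHess.integral_hess_inner`). And `ΔW` is, in the
annulus, a multiple of the harmonic function `x₁ (γ + 1 / |x|²)`. Since `Δw = 0` in the disc, `ΔW`
can be replaced there by a `C^{1,1}` continuation; two integrations by parts move the Laplacian onto
the continuation, whose Laplacian lives in the disc only, and there `w` is affine
(`integral_laplacian_dipole_mul`).

Strict positivity of the form comes from `(Δw)² ≤ 2 |∇²w|²` and `ν < 1/2` (`le_hessForm_self`)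
together with Poincaré's inequality in `H²₀` (`MemH20.ae_eq_zero`).

That `W` belongs to `H²₀(B_R)` is seen on its radial profile: `W = x₁ F(|x|²)`, where `F`, extended
by constants outside `[ε², R²]`, is of class `C^{1,1}`. Lipschitz functions have their almost
everywhere derivative as weak derivative (`isWeakPartial_of_lipschitzOnWith`), and smooth
truncations of `F''`, integrated twice, give the approximating test functions (`memH20_radialField`).
-/

namespace AiryDipole

/-! ### Weak derivatives on open sets -/

section WeakDerivatives

variable {Ω : Set Plane} {i j : Fin 2} {u v g g' : Plane → ℝ}

theorem IsTestFunction.continuous {φ : Plane → ℝ} (hφ : IsTestFunction Ω φ) : Continuous φ :=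
  hφ.1.continuous

theorem IsTestFunction.mono {Ω' : Set Plane} {φ : Plane → ℝ} (hφ : IsTestFunction Ω' φ)
    (h : Ω' ⊆ Ω) : IsTestFunction Ω φ :=
  ⟨hφ.1, hφ.2.1, hφ.2.2.trans h⟩

theorem IsTestFunction.sub {φ ψ : Plane → ℝ} (hφ : IsTestFunction Ω φ) (hψ : IsTestFunction Ω ψ) :
    IsTestFunction Ω (fun x => φ x - ψ x) := by
  refine ⟨hφ.1.sub hψ.1, hφ.2.1.sub hψ.2.1, ?_⟩
  exact (tsupport_sub φ ψ).trans (Set.union_subset hφ.2.2 hψ.2.2)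

theorem IsTestFunction.partialDeriv {φ : Plane → ℝ} (hφ : IsTestFunction Ω φ) (i : Fin 2) :
    IsTestFunction Ω (partialDeriv i φ) := by
  refine ⟨?_, ?_, ?_⟩
  · exact (hφ.1.fderiv_right (m := ∞) (by simp)).clm_apply contDiff_const
  · exact hφ.2.1.fderiv_apply (𝕜 := ℝ) _
  · exact (tsupport_fderiv_apply_subset ℝ _).trans hφ.2.2

theorem IsTestFunction.eq_zero_of_notMem {φ : Plane → ℝ} (hφ : IsTestFunction Ω φ) {x : Plane}
    (hx : x ∉ Ω) : φ x = 0 :=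
  image_eq_zero_of_notMem_tsupport fun h => hx (hφ.2.2 h)

theorem IsTestFunction.setIntegral_mul {φ : Plane → ℝ} (hφ : IsTestFunction Ω φ) (f : Plane → ℝ) :
    ∫ x in Ω, f x * φ x = ∫ x, f x * φ x :=
  setIntegral_eq_integral_of_forall_compl_eq_zero fun x hx => by
    rw [hφ.eq_zero_of_notMem hx, mul_zero]

theorem IsTestFunction.memLp {φ : Plane → ℝ} (hφ : IsTestFunction Ω φ) (p : ENNReal) :
    MemLp φ p (volume.restrict Ω) :=
  (hφ.continuous.memLp_of_hasCompactSupport hφ.2.1).restrict _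

theorem IsTestFunction.partialDeriv_comm {φ : Plane → ℝ} (hφ : IsTestFunction Ω φ) (i j : Fin 2) :
    AiryDipole.partialDeriv i (AiryDipole.partialDeriv j φ) =
      AiryDipole.partialDeriv j (AiryDipole.partialDeriv i φ) := by
  funext x
  have hs : IsSymmSndFDerivAt ℝ φ x :=
    (contDiff_infty.1 hφ.1 2).contDiffAt.isSymmSndFDerivAt (by simp)
  have hd : DifferentiableAt ℝ (fderiv ℝ φ) x :=
    ((hφ.1.fderiv_right (m := ∞) (by simp)).differentiable (by simp)) x
  have key : ∀ a b : Fin 2, AiryDipole.partialDeriv a (AiryDipole.partialDeriv b φ) x =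
      fderiv ℝ (fderiv ℝ φ) x (EuclideanSpace.single a 1) (EuclideanSpace.single b 1) := by
    intro a b
    have := (hd.hasFDerivAt.clm_apply
      (hasFDerivAt_const (EuclideanSpace.single b (1 : ℝ)) x)).fderiv
    change fderiv ℝ (fun y => fderiv ℝ φ y (EuclideanSpace.single b 1)) x _ = _
    rw [this]
    simp
  rw [key, key]
  exact hs _ _

theorem IsTestFunction.integrable_mul {φ : Plane → ℝ} (hφ : IsTestFunction Ω φ)
    (hu : LocallyIntegrableOn u Ω) : Integrable (fun x => u x * φ x) (volume.restrict Ω) := by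
  have h : IntegrableOn (fun x => u x * φ x) (tsupport φ) :=
    (hu.integrableOn_compact_subset hφ.2.2 hφ.2.1).mul_continuousOn hφ.continuous.continuousOn
      hφ.2.1
  have h' : Integrable (fun x => u x * φ x) := by
    rwa [integrableOn_iff_integrable_of_support_subset] at h
    intro x hx
    exact subset_tsupport _ (right_ne_zero_of_mul hx)
  exact h'.restrict

/-- On an open set, the weak derivative is unique almost everywhere. -/
theorem IsWeakPartial.ae_eq (hΩ : IsOpen Ω) (h : IsWeakPartial Ω i u g)
    (h' : IsWeakPartial Ω i u g') : g =ᵐ[volume.restrict Ω] g' := by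
  have key := IsOpen.ae_eq_zero_of_integral_contDiff_smul_eq_zero (μ := volume) hΩ
    (h.2.1.sub h'.2.1) ?_
  · filter_upwards [(ae_restrict_iff' hΩ.measurableSet).2 key] with x hx
    exact sub_eq_zero.1 hx
  · intro φ h1 h2 h3
    have hφ : IsTestFunction Ω φ := ⟨h1, h2, h3⟩
    have e1 := h.2.2 φ hφ
    rw [h'.2.2 φ hφ, neg_inj] at e1
    have e2 : ∫ x, φ x • (g - g') x = ∫ x in Ω, (g x * φ x - g' x * φ x) := by
      rw [setIntegral_eq_integral_of_forall_compl_eq_zero]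
      · refine integral_congr_ae (ae_of_all _ fun x => ?_)
        simp only [Pi.sub_apply, smul_eq_mul]; ring
      · intro x hx; rw [hφ.eq_zero_of_notMem hx]; ring
    rw [e2, integral_sub (hφ.integrable_mul h.2.1) (hφ.integrable_mul h'.2.1), e1, sub_self]

theorem locallyIntegrableOn_congr_ae (h : LocallyIntegrableOn u Ω)
    (huv : u =ᵐ[volume.restrict Ω] v) : LocallyIntegrableOn v Ω := by
  intro x hx
  obtain ⟨s, hs, hi⟩ := h x hx
  refine ⟨s ∩ Ω, inter_mem hs self_mem_nhdsWithin, ?_⟩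
  exact (hi.mono_set Set.inter_subset_left).congr
    (ae_restrict_of_ae_restrict_of_subset Set.inter_subset_right huv)

theorem IsWeakPartial.congr (h : IsWeakPartial Ω i u g)
    (hu : u =ᵐ[volume.restrict Ω] v) (hg : g =ᵐ[volume.restrict Ω] g') :
    IsWeakPartial Ω i v g' := by
  refine ⟨locallyIntegrableOn_congr_ae h.1 hu, locallyIntegrableOn_congr_ae h.2.1 hg,
    fun φ hφ => ?_⟩
  have e1 : ∫ x in Ω, v x * AiryDipole.partialDeriv i φ x =
      ∫ x in Ω, u x * AiryDipole.partialDeriv i φ x :=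
    integral_congr_ae (by filter_upwards [hu] with x hx; rw [hx])
  have e2 : ∫ x in Ω, g' x * φ x = ∫ x in Ω, g x * φ x :=
    integral_congr_ae (by filter_upwards [hg] with x hx; rw [hx])
  rw [e1, e2, h.2.2 φ hφ]

theorem IsWeakPartial.mono {Ω' : Set Plane} (h : IsWeakPartial Ω i u g) (hΩ' : Ω' ⊆ Ω) :
    IsWeakPartial Ω' i u g := by
  refine ⟨h.1.mono_set hΩ', h.2.1.mono_set hΩ', fun φ hφ => ?_⟩
  have := h.2.2 φ (hφ.mono hΩ')
  rw [(hφ.partialDeriv i).setIntegral_mul, hφ.setIntegral_mul]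
  rwa [((hφ.mono hΩ').partialDeriv i).setIntegral_mul, (hφ.mono hΩ').setIntegral_mul] at this

theorem IsWeakPartial.sub (h : IsWeakPartial Ω i u g) (h' : IsWeakPartial Ω i v g') :
    IsWeakPartial Ω i (fun x => u x - v x) (fun x => g x - g' x) := by
  refine ⟨h.1.sub h'.1, h.2.1.sub h'.2.1, fun φ hφ => ?_⟩
  have hp := hφ.partialDeriv i
  simp_rw [sub_mul]
  rw [integral_sub (hp.integrable_mul h.1) (hp.integrable_mul h'.1),
    integral_sub (hφ.integrable_mul h.2.1) (hφ.integrable_mul h'.2.1), h.2.2 φ hφ, h'.2.2 φ hφ]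
  ring

theorem isWeakPartial_weakPartial (h : ∃ g, IsWeakPartial Ω i u g) :
    IsWeakPartial Ω i u (weakPartial Ω i u) := by
  rw [weakPartial, dif_pos h]
  exact h.choose_spec

/-- A function which is Lipschitz on an open set and has there almost everywhere a classical
derivative `g x` in direction `eᵢ` has `g` as weak derivative. -/
theorem isWeakPartial_of_lipschitzOnWith (hΩ : IsOpen Ω) {C : NNReal}
    (hu : LipschitzOnWith C u Ω)
    (hd : ∀ᵐ x ∂(volume.restrict Ω), HasLineDerivAt ℝ u (g x) x (EuclideanSpace.single i 1)) :
    IsWeakPartial Ω i u g ∧ MemLp g ⊤ (volume.restrict Ω) := by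
  obtain ⟨U, hU, hUu⟩ := hu.extend_real
  have hg : g =ᵐ[volume.restrict Ω] fun x => lineDeriv ℝ U x (EuclideanSpace.single i 1) := by
    filter_upwards [hd, ae_restrict_mem hΩ.measurableSet] with x hx hxΩ
    refine (HasLineDerivAt.lineDeriv ?_).symm
    exact hx.congr_of_eventuallyEq
      (Filter.eventuallyEq_of_mem (hΩ.mem_nhds hxΩ) fun y hy => (hUu hy).symm)
  have hgU : MemLp (fun x => lineDeriv ℝ U x (EuclideanSpace.single i 1)) ⊤
      (volume.restrict Ω) := (hU.memLp_lineDeriv (μ := volume) _).restrict _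
  have hUw : IsWeakPartial Ω i U (fun x => lineDeriv ℝ U x (EuclideanSpace.single i 1)) := by
    refine ⟨(hU.continuous.locallyIntegrable).locallyIntegrableOn _,
      (hU.locallyIntegrable_lineDeriv _).locallyIntegrableOn _, fun φ hφ => ?_⟩
    rw [(hφ.partialDeriv i).setIntegral_mul, hφ.setIntegral_mul]
    obtain ⟨D, hD⟩ := hφ.1.lipschitzWith_of_hasCompactSupport hφ.2.1 (by simp)
    rw [hU.integral_lineDeriv_mul_eq hD hφ.2.1, ← integral_neg]
    refine integral_congr_ae (ae_of_all _ fun x => ?_)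
    have := (hφ.1.differentiable (by simp) x).lineDeriv_eq_fderiv
      (v := EuclideanSpace.single i (1 : ℝ))
    simp only [lineDeriv_neg, this, AiryDipole.partialDeriv]
    ring
  refine ⟨hUw.congr ?_ hg.symm, hgU.ae_eq hg.symm⟩
  filter_upwards [ae_restrict_mem hΩ.measurableSet] with x hx using (hUu hx).symm

theorem IsTestFunction.isWeakPartial (hΩ : IsOpen Ω) {φ : Plane → ℝ} (hφ : IsTestFunction Ω φ)
    (i : Fin 2) : IsWeakPartial Ω i φ (AiryDipole.partialDeriv i φ) := by
  obtain ⟨D, hD⟩ := hφ.1.lipschitzWith_of_hasCompactSupport hφ.2.1 (by simp)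
  refine (isWeakPartial_of_lipschitzOnWith hΩ (hD.lipschitzOnWith (s := Ω)) ?_).1
  exact ae_of_all _ fun x => (hφ.1.differentiable (by simp) x).hasFDerivAt.hasLineDerivAt _

end WeakDerivatives

/-! ### The spaces `H²` and `H²₀` -/

/-- `u` lies in `H²(Ω)`, with weak gradient `g` and weak Hessian `h`. Fixing the derivatives as
data avoids the choice made in `weakPartial`. -/
structure HasWeakHess (Ω : Set Plane) (u : Plane → ℝ) (g : Fin 2 → Plane → ℝ)
    (h : Fin 2 → Fin 2 → Plane → ℝ) : Prop where
  memLp : MemLp u 2 (volume.restrict Ω)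
  isWeakPartial : ∀ j, IsWeakPartial Ω j u (g j)
  memLp_grad : ∀ j, MemLp (g j) 2 (volume.restrict Ω)
  isWeakPartial_grad : ∀ i j, IsWeakPartial Ω i (g j) (h i j)
  memLp_hess : ∀ i j, MemLp (h i j) 2 (volume.restrict Ω)

section

variable {Ω : Set Plane} {u v : Plane → ℝ} {g g' : Fin 2 → Plane → ℝ}
  {h h' : Fin 2 → Fin 2 → Plane → ℝ}

theorem HasWeakHess.memH2 (H : HasWeakHess Ω u g h) : MemH2 Ω u :=
  ⟨H.memLp, fun j => ⟨g j, H.isWeakPartial j, H.memLp_grad j,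
    fun i => ⟨h i j, H.isWeakPartial_grad i j, H.memLp_hess i j⟩⟩⟩

theorem HasWeakHess.sub (H : HasWeakHess Ω u g h) (H' : HasWeakHess Ω v g' h') :
    HasWeakHess Ω (fun x => u x - v x) (fun j x => g j x - g' j x)
      (fun i j x => h i j x - h' i j x) where
  memLp := H.memLp.sub H'.memLp
  isWeakPartial j := (H.isWeakPartial j).sub (H'.isWeakPartial j)
  memLp_grad j := (H.memLp_grad j).sub (H'.memLp_grad j)
  isWeakPartial_grad i j := (H.isWeakPartial_grad i j).sub (H'.isWeakPartial_grad i j)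
  memLp_hess i j := (H.memLp_hess i j).sub (H'.memLp_hess i j)

theorem HasWeakHess.weakPartial_ae (hΩ : IsOpen Ω) (H : HasWeakHess Ω u g h) (j : Fin 2) :
    weakPartial Ω j u =ᵐ[volume.restrict Ω] g j :=
  (isWeakPartial_weakPartial ⟨_, H.isWeakPartial j⟩).ae_eq hΩ (H.isWeakPartial j)

theorem HasWeakHess.isWeakPartial_weakHess (hΩ : IsOpen Ω) (H : HasWeakHess Ω u g h)
    (i j : Fin 2) : IsWeakPartial Ω i (weakPartial Ω j u) (h i j) :=
  (H.isWeakPartial_grad i j).congr (H.weakPartial_ae hΩ j).symm Filter.EventuallyEq.rfl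

theorem HasWeakHess.weakHess_ae (hΩ : IsOpen Ω) (H : HasWeakHess Ω u g h) (i j : Fin 2) :
    weakHess Ω i j u =ᵐ[volume.restrict Ω] h i j :=
  (isWeakPartial_weakPartial ⟨_, H.isWeakPartial_weakHess hΩ i j⟩).ae_eq hΩ
    (H.isWeakPartial_weakHess hΩ i j)

theorem MemH2.hasWeakHess (hΩ : IsOpen Ω) (hu : MemH2 Ω u) :
    HasWeakHess Ω u (fun j => weakPartial Ω j u) (fun i j => weakHess Ω i j u) := by
  choose hu0 g hg hg1 using hu
  choose hg2 k hk hk2 using hg1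
  have H : HasWeakHess Ω u g (fun i j => k j i) :=
    ⟨hu0, hg, hg2, fun i j => hk j i, fun i j => hk2 j i⟩
  refine ⟨hu0, fun j => isWeakPartial_weakPartial ⟨_, hg j⟩,
    fun j => (hg2 j).ae_eq (H.weakPartial_ae hΩ j).symm,
    fun i j => isWeakPartial_weakPartial ⟨_, H.isWeakPartial_weakHess hΩ i j⟩,
    fun i j => (hk2 j i).ae_eq (H.weakHess_ae hΩ i j).symm⟩

theorem IsTestFunction.hasWeakHess (hΩ : IsOpen Ω) {φ : Plane → ℝ} (hφ : IsTestFunction Ω φ) :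
    HasWeakHess Ω φ (fun j => AiryDipole.partialDeriv j φ)
      (fun i j => AiryDipole.partialDeriv i (AiryDipole.partialDeriv j φ)) :=
  ⟨hφ.memLp 2, fun j => hφ.isWeakPartial hΩ j, fun j => (hφ.partialDeriv j).memLp 2,
    fun i j => (hφ.partialDeriv j).isWeakPartial hΩ i,
    fun i j => ((hφ.partialDeriv j).partialDeriv i).memLp 2⟩

theorem HasWeakHess.h2Norm_eq (hΩ : IsOpen Ω) (H : HasWeakHess Ω u g h) :
    h2Norm Ω u = eLpNorm u 2 (volume.restrict Ω) + ∑ i, eLpNorm (g i) 2 (volume.restrict Ω) +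
      ∑ i, ∑ j, eLpNorm (h i j) 2 (volume.restrict Ω) := by
  unfold h2Norm
  congr 1
  · congr 1
    exact Finset.sum_congr rfl fun i _ => eLpNorm_congr_ae (H.weakPartial_ae hΩ i)
  · exact Finset.sum_congr rfl fun i _ => Finset.sum_congr rfl fun j _ =>
      eLpNorm_congr_ae (H.weakHess_ae hΩ i j)

theorem HasWeakHess.h2Norm_sub_le (hΩ : IsOpen Ω) (H : HasWeakHess Ω u g h)
    (H' : HasWeakHess Ω v g' h') :
    h2Norm Ω (fun x => u x - v x) ≤ h2Norm Ω u + h2Norm Ω v := by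
  rw [(H.sub H').h2Norm_eq hΩ, H.h2Norm_eq hΩ, H'.h2Norm_eq hΩ]
  have e0 := eLpNorm_sub_le H.memLp.1 H'.memLp.1 (p := 2) (by norm_num)
  have e1 : ∀ i, _ := fun i =>
    eLpNorm_sub_le (H.memLp_grad i).1 (H'.memLp_grad i).1 (p := 2) (by norm_num)
  have e2 : ∀ i j, _ := fun i j =>
    eLpNorm_sub_le (H.memLp_hess i j).1 (H'.memLp_hess i j).1 (p := 2) (by norm_num)
  refine (add_le_add (add_le_add e0 (Finset.sum_le_sum fun i _ => e1 i))
    (Finset.sum_le_sum fun i _ => Finset.sum_le_sum fun j _ => e2 i j)).trans (le_of_eq ?_)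
  simp only [Finset.sum_add_distrib]
  ring

theorem MemH20.sub (hΩ : IsOpen Ω) (hu : MemH20 Ω u) (hv : MemH20 Ω v) :
    MemH20 Ω (fun x => u x - v x) := by
  obtain ⟨hu2, φ, hφ, hφt⟩ := hu
  obtain ⟨hv2, ψ, hψ, hψt⟩ := hv
  have Hu := hu2.hasWeakHess hΩ
  have Hv := hv2.hasWeakHess hΩ
  refine ⟨(Hu.sub Hv).memH2, fun n x => φ n x - ψ n x, fun n => (hφ n).sub (hψ n), ?_⟩
  have hlim := hφt.add hψt
  rw [add_zero] at hlim
  refine tendsto_of_tendsto_of_tendsto_of_le_of_le tendsto_const_nhds hlim (fun _ => zero_le)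
    fun n => ?_
  have Hun := Hu.sub ((hφ n).hasWeakHess hΩ)
  have Hvn := Hv.sub ((hψ n).hasWeakHess hΩ)
  have hw : (fun x => u x - v x - (φ n x - ψ n x)) =
      fun x => (u x - φ n x) - (v x - ψ n x) := by funext x; ring
  rw [hw]
  exact Hun.h2Norm_sub_le hΩ Hvn

/-- The approximating sequence of a function in `H²₀`, with convergence of each derivative. -/
theorem MemH20.exists_seq (hΩ : IsOpen Ω) (hu : MemH20 Ω u) (H : HasWeakHess Ω u g h) :
    ∃ φ : ℕ → Plane → ℝ, (∀ n, IsTestFunction Ω (φ n)) ∧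
      Tendsto (fun n => eLpNorm (fun x => u x - φ n x) 2 (volume.restrict Ω)) atTop (𝓝 0) ∧
      ∀ i j, Tendsto (fun n => eLpNorm
        (fun x => h i j x - partialDeriv i (partialDeriv j (φ n)) x) 2 (volume.restrict Ω))
        atTop (𝓝 0) := by
  obtain ⟨-, φ, hφ, hφt⟩ := hu
  have hle : ∀ n, _ := fun n => (H.sub ((hφ n).hasWeakHess hΩ)).h2Norm_eq hΩ
  refine ⟨φ, hφ, ?_, fun i j => ?_⟩
  · refine tendsto_of_tendsto_of_tendsto_of_le_of_le tendsto_const_nhds hφt (fun _ => zero_le)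
      fun n => ?_
    simp only [hle n, add_assoc]
    exact le_self_add
  · refine tendsto_of_tendsto_of_tendsto_of_le_of_le tendsto_const_nhds hφt (fun _ => zero_le)
      fun n => ?_
    simp only [hle n]
    refine le_trans ?_ le_add_self
    refine le_trans ?_ (Finset.single_le_sum (fun _ _ => zero_le) (Finset.mem_univ i))
    exact Finset.single_le_sum (f := fun j => eLpNorm
        (fun x => h i j x - partialDeriv i (partialDeriv j (φ n)) x) 2 (volume.restrict Ω))
        (fun _ _ => zero_le) (Finset.mem_univ j)

/-- Integration against a fixed `L²` function is continuous for `L²` convergence. -/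
theorem tendsto_integral_mul {α : Type*} [MeasurableSpace α] {μ : Measure α} {f k : α → ℝ}
    {kn : ℕ → α → ℝ} (hf : MemLp f 2 μ) (hk : MemLp k 2 μ) (hkn : ∀ n, MemLp (kn n) 2 μ)
    (ht : Tendsto (fun n => eLpNorm (fun x => k x - kn n x) 2 μ) atTop (𝓝 0)) :
    Tendsto (fun n => ∫ x, f x * kn n x ∂μ) atTop (𝓝 (∫ x, f x * k x ∂μ)) := by
  refine tendsto_integral_of_L1 _ (hf.integrable_mul hk).1
    (Eventually.of_forall fun n => hf.integrable_mul (hkn n)) ?_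
  have hlim : Tendsto (fun n => eLpNorm f 2 μ * eLpNorm (fun x => k x - kn n x) 2 μ) atTop
      (𝓝 0) := by
    have := ENNReal.Tendsto.const_mul (a := eLpNorm f 2 μ) ht (Or.inr hf.2.ne)
    rwa [mul_zero] at this
  refine tendsto_of_tendsto_of_tendsto_of_le_of_le tendsto_const_nhds hlim (fun _ => zero_le)
    fun n => ?_
  have := eLpNorm_smul_le_mul_eLpNorm (p := 2) (q := 2) (r := 1) (hk.sub (hkn n)).1 hf.1
  rw [eLpNorm_one_eq_lintegral_enorm] at this
  refine le_trans (le_of_eq ?_) this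
  refine lintegral_congr fun x => ?_
  rw [← enorm_neg]
  congr 1
  simp only [Pi.smul_apply', Pi.sub_apply, Pi.mul_apply, smul_eq_mul]
  ring

/-- Integrating by parts twice against a test function. -/
theorem HasWeakHess.integral_mul_partialDeriv (H : HasWeakHess Ω u g h) {φ : Plane → ℝ}
    (hφ : IsTestFunction Ω φ) (i j : Fin 2) :
    ∫ x in Ω, u x * partialDeriv j (partialDeriv i φ) x = ∫ x in Ω, h i j x * φ x := by
  rw [(H.isWeakPartial j).2.2 _ (hφ.partialDeriv i), (H.isWeakPartial_grad i j).2.2 _ hφ, neg_neg]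

/-- For `w ∈ H²₀`, the formula `∫ u ∂ᵢᵢ w = ∫ ∂ᵢᵢ u w` holds for all `u ∈ H²`. -/
theorem HasWeakHess.integral_mul_hess (hΩ : IsOpen Ω) (H : HasWeakHess Ω u g h)
    (hv : MemH20 Ω v) (H' : HasWeakHess Ω v g' h') (i : Fin 2) :
    ∫ x in Ω, u x * h' i i x = ∫ x in Ω, h i i x * v x := by
  obtain ⟨φ, hφ, h0, h2⟩ := hv.exists_seq hΩ H'
  have t1 := tendsto_integral_mul H.memLp (H'.memLp_hess i i)
    (fun n => ((hφ n).hasWeakHess hΩ).memLp_hess i i) (h2 i i)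
  have t2 := tendsto_integral_mul (H.memLp_hess i i) H'.memLp (fun n => (hφ n).memLp 2) h0
  refine tendsto_nhds_unique t1 (t2.congr fun n => ?_)
  rw [H.integral_mul_partialDeriv (hφ n)]

/-- On `H²₀` the Hessian form and the product of Laplacians have the same integral: the factors
`∂ᵢ∂ⱼu ∂ᵢ∂ⱼv` and `∂ᵢ∂ᵢu ∂ⱼ∂ⱼv` differ by null Lagrangians. -/
theorem HasWeakHess.integral_hess_inner (hΩ : IsOpen Ω) (H : HasWeakHess Ω u g h)
    (hv : MemH20 Ω v) (H' : HasWeakHess Ω v g' h') :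
    ∑ i, ∑ j, ∫ x in Ω, h i j x * h' i j x = ∑ i, ∑ j, ∫ x in Ω, h i i x * h' j j x := by
  obtain ⟨φ, hφ, h0, h2⟩ := hv.exists_seq hΩ H'
  have t1 := tendsto_finsetSum Finset.univ fun i _ => tendsto_finsetSum Finset.univ
    fun j _ => tendsto_integral_mul (H.memLp_hess i j) (H'.memLp_hess i j)
      (fun n => ((hφ n).hasWeakHess hΩ).memLp_hess i j) (h2 i j)
  have t2 := tendsto_finsetSum Finset.univ fun i _ => tendsto_finsetSum Finset.univ
    fun j _ => tendsto_integral_mul (H.memLp_hess i i) (H'.memLp_hess j j)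
      (fun n => ((hφ n).hasWeakHess hΩ).memLp_hess j j) (h2 j j)
  refine tendsto_nhds_unique t1 (t2.congr fun n => ?_)
  have hd : ∀ a b c k : Fin 2, ∫ x in Ω, h k c x * partialDeriv a (partialDeriv b (φ n)) x =
      -∫ x in Ω, g c x * partialDeriv k (partialDeriv a (partialDeriv b (φ n))) x := by
    intro a b c k
    rw [(H.isWeakPartial_grad k c).2.2 _ (((hφ n).partialDeriv b).partialDeriv a), neg_neg]
  rw [Finset.sum_comm]
  refine Finset.sum_congr rfl fun j _ => Finset.sum_congr rfl fun i _ => ?_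
  rw [hd j j i i, hd j i i j, (((hφ n).partialDeriv j).partialDeriv_comm i j),
    (hφ n).partialDeriv_comm i j]

end

/-! ### Vanishing of `H²₀` functions with vanishing Hessian -/

theorem hasFDerivAt_coord (i : Fin 2) (x : Plane) :
    HasFDerivAt (fun y : Plane => y i) (EuclideanSpace.proj i : Plane →L[ℝ] ℝ) x :=
  (EuclideanSpace.proj i : Plane →L[ℝ] ℝ).hasFDerivAt

theorem abs_coord_le_norm (x : Plane) (i : Fin 2) : |x i| ≤ ‖x‖ := by
  simpa using PiLp.norm_apply_le x i

/-- Poincaré's inequality in the ball. It results from `∫ φ² = -2 ∫ x₁ φ ∂₁φ`. -/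
theorem poincare_ball {R : ℝ} {φ : Plane → ℝ} (hφ : IsTestFunction (ball 0 R) φ) (i : Fin 2) :
    ∫ x in ball 0 R, φ x ^ 2 ≤ (2 * R) ^ 2 * ∫ x in ball 0 R, partialDeriv i φ x ^ 2 := by
  have hc := hφ.continuous
  have hc' := (hφ.partialDeriv i).continuous
  have hd : ∀ x, HasFDerivAt (fun y => φ y ^ 2) ((2 * φ x) • fderiv ℝ φ x) x := fun x => by
    simpa using (hφ.1.differentiable (by simp) x).hasFDerivAt.pow 2
  have hsupp : ∀ f : Plane → ℝ, Continuous f → Integrable (fun x => f x * φ x) := fun f hf =>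
    (hf.mul hc).integrable_of_hasCompactSupport hφ.2.1.mul_left
  have hsupp' : ∀ f : Plane → ℝ, Continuous f → Integrable (fun x => f x * partialDeriv i φ x) :=
    fun f hf => (hf.mul hc').integrable_of_hasCompactSupport (hφ.partialDeriv i).2.1.mul_left
  have hx : Continuous fun x : Plane => x i := by fun_prop
  have key := integral_mul_fderiv_eq_neg_fderiv_mul_of_integrable (μ := (volume : Measure Plane))
    (𝕜 := ℝ) (f := fun x : Plane => x i) (g := fun x => φ x ^ 2)
    (v := EuclideanSpace.single i (1 : ℝ))
    ?_ ?_ ?_ (fun x _ => (hasFDerivAt_coord i x).differentiableAt)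
    (fun x _ => (hd x).differentiableAt)
  · simp only [(hd _).fderiv, (hasFDerivAt_coord i _).fderiv] at key
    have key' : ∫ x, x i * (2 * φ x * partialDeriv i φ x) = -∫ x, φ x ^ 2 := by
      simpa [partialDeriv] using key
    rw [setIntegral_eq_integral_of_forall_compl_eq_zero (fun x hx => by
        rw [hφ.eq_zero_of_notMem hx]; ring),
      setIntegral_eq_integral_of_forall_compl_eq_zero (fun x hx => by
        rw [(hφ.partialDeriv i).eq_zero_of_notMem hx]; ring)]
    have i1 : Integrable fun x => φ x ^ 2 := by simpa [sq] using hsupp φ hc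
    have i2 : Integrable fun x => partialDeriv i φ x ^ 2 := by simpa [sq] using hsupp' _ hc'
    have i3 : Integrable fun x : Plane => x i * (2 * φ x * partialDeriv i φ x) := by
      simpa [mul_assoc] using hsupp' (fun x => x i * (2 * φ x)) (by fun_prop)
    have hle : ∫ x, (-(x i * (2 * φ x * partialDeriv i φ x))) ≤
        ∫ x, ((1 / 2) * φ x ^ 2 + (2 * R ^ 2) * partialDeriv i φ x ^ 2) := by
      refine integral_mono i3.neg ((i1.const_mul _).add (i2.const_mul _)) fun x => ?_
      by_cases hx : x ∈ ball (0 : Plane) R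
      · have hxR : |x i| ≤ R := (abs_coord_le_norm x i).trans (mem_ball_zero_iff.1 hx).le
        have h2 : x i ^ 2 ≤ R ^ 2 := sq_le_sq' (by linarith [abs_le.1 hxR]) (abs_le.1 hxR).2
        have h3 := mul_le_mul_of_nonneg_right h2 (sq_nonneg (partialDeriv i φ x))
        simp only
        nlinarith [sq_nonneg (φ x + 2 * x i * partialDeriv i φ x)]
      · simp only [hφ.eq_zero_of_notMem hx, (hφ.partialDeriv i).eq_zero_of_notMem hx]
        simp
    rw [integral_neg, key', integral_add (i1.const_mul _) (i2.const_mul _), integral_const_mul,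
      integral_const_mul] at hle
    linarith
  · simp only [(hasFDerivAt_coord i _).fderiv]
    simpa [sq] using hsupp φ hc
  · simp only [(hd _).fderiv]
    simpa [mul_assoc, partialDeriv] using hsupp' (fun x => x i * (2 * φ x)) (by fun_prop)
  · simpa [sq, mul_assoc] using hsupp (fun x => x i * φ x) (by fun_prop)

theorem eLpNorm_two_eq_ofReal_sqrt {α : Type*} [MeasurableSpace α] {μ : Measure α} {f : α → ℝ}
    (hf : MemLp f 2 μ) : eLpNorm f 2 μ = ENNReal.ofReal √(∫ x, f x ^ 2 ∂μ) := by
  rw [hf.eLpNorm_eq_integral_rpow_norm (by norm_num) (by norm_num), Real.sqrt_eq_rpow]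
  simp

theorem eLpNorm_two_le_of_integral_sq_le {α : Type*} [MeasurableSpace α] {μ : Measure α}
    {a b : α → ℝ} {C : ℝ} (hC : 0 ≤ C) (ha : MemLp a 2 μ) (hb : MemLp b 2 μ)
    (h : ∫ x, a x ^ 2 ∂μ ≤ C ^ 2 * ∫ x, b x ^ 2 ∂μ) :
    eLpNorm a 2 μ ≤ ENNReal.ofReal C * eLpNorm b 2 μ := by
  rw [eLpNorm_two_eq_ofReal_sqrt ha, eLpNorm_two_eq_ofReal_sqrt hb, ← ENNReal.ofReal_mul hC]
  refine ENNReal.ofReal_le_ofReal ?_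
  calc √(∫ x, a x ^ 2 ∂μ) ≤ √(C ^ 2 * ∫ x, b x ^ 2 ∂μ) := Real.sqrt_le_sqrt h
    _ = C * √(∫ x, b x ^ 2 ∂μ) := by rw [Real.sqrt_mul (sq_nonneg _), Real.sqrt_sq hC]

theorem MemH20.ae_eq_zero {R : ℝ} (hR : 0 < R) {u : Plane → ℝ} (hu : MemH20 (ball 0 R) u)
    {g : Fin 2 → Plane → ℝ} {h : Fin 2 → Fin 2 → Plane → ℝ} (H : HasWeakHess (ball 0 R) u g h)
    (h0 : h 0 0 =ᵐ[volume.restrict (ball 0 R)] 0) : u =ᵐ[volume.restrict (ball 0 R)] 0 := by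
  obtain ⟨φ, hφ, t0, t2⟩ := hu.exists_seq isOpen_ball H
  have hC : (0 : ℝ) ≤ 2 * R := by linarith
  have hφle : ∀ n, eLpNorm (φ n) 2 (volume.restrict (ball 0 R)) ≤ ENNReal.ofReal (2 * R) *
      (ENNReal.ofReal (2 * R) * eLpNorm (fun x => h 0 0 x - partialDeriv 0 (partialDeriv 0 (φ n)) x)
        2 (volume.restrict (ball 0 R))) := fun n => by
    have d1 := (hφ n).partialDeriv 0
    have d2 := d1.partialDeriv 0
    have e1 := eLpNorm_two_le_of_integral_sq_le hC ((hφ n).memLp 2) (d1.memLp 2)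
      (poincare_ball (hφ n) 0)
    have e2 := eLpNorm_two_le_of_integral_sq_le hC (d1.memLp 2) (d2.memLp 2) (poincare_ball d1 0)
    refine e1.trans (mul_le_mul_right (e2.trans (mul_le_mul_right (le_of_eq ?_) _)) _)
    rw [← eLpNorm_neg]
    refine eLpNorm_congr_ae ?_
    filter_upwards [h0] with x hx
    simp [hx]
  have hle : ∀ n, eLpNorm u 2 (volume.restrict (ball 0 R)) ≤
      eLpNorm (fun x => u x - φ n x) 2 (volume.restrict (ball 0 R)) + ENNReal.ofReal (2 * R) *
      (ENNReal.ofReal (2 * R) * eLpNorm (fun x => h 0 0 x - partialDeriv 0 (partialDeriv 0 (φ n)) x)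
        2 (volume.restrict (ball 0 R))) := fun n => by
    refine le_trans ?_ (add_le_add_right (hφle n) _)
    have := eLpNorm_add_le (H.memLp.sub ((hφ n).memLp 2)).1 ((hφ n).memLp 2).1 (p := 2)
      (by norm_num)
    rwa [sub_add_cancel] at this
  have hlim := t0.add (ENNReal.Tendsto.const_mul (a := ENNReal.ofReal (2 * R))
    (ENNReal.Tendsto.const_mul (a := ENNReal.ofReal (2 * R)) (t2 0 0)
      (Or.inr ENNReal.ofReal_ne_top)) (Or.inr ENNReal.ofReal_ne_top))
  simp only [mul_zero, add_zero] at hlim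
  have hz : eLpNorm u 2 (volume.restrict (ball 0 R)) = 0 :=
    le_antisymm (ge_of_tendsto' hlim hle) zero_le
  exact (eLpNorm_eq_zero_iff H.memLp.1 (by norm_num)).1 hz

/-! ### The length of a circle and traces of constants -/

theorem boundaryTrace_eq_const {ε c : ℝ} {f : Plane → ℝ}
    (hf : ∀ᵐ x ∂(volume.restrict (ball (0 : Plane) ε)), f x = c) (hε : 0 < ε) {x : Plane}
    (hx : x ∈ sphere (0 : Plane) ε) : boundaryTrace (ball 0 ε) f x = c := by
  refine Tendsto.limUnder_eq (tendsto_const_nhds.congr' ?_)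
  filter_upwards [self_mem_nhdsWithin] with r (hr : 0 < r)
  have hne : (ball x r ∩ ball 0 ε).Nonempty := by
    have hcl : x ∈ closure (ball (0 : Plane) ε) := by
      rw [closure_ball _ hε.ne']; exact sphere_subset_closedBall hx
    exact mem_closure_iff.1 hcl _ isOpen_ball (mem_ball_self hr)
  have hpos := (isOpen_ball.inter isOpen_ball).measure_ne_zero (volume : Measure Plane) hne
  have hfin : volume (ball x r ∩ ball 0 ε) ≠ ⊤ :=
    ((measure_mono Set.inter_subset_left).trans_lt measure_ball_lt_top).ne
  rw [setAverage_congr_fun (g := fun _ => c) (measurableSet_ball.inter measurableSet_ball),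
    setAverage_const hpos hfin]
  have := ae_restrict_of_ae_restrict_of_subset (Set.inter_subset_right (s := ball x r)) hf
  exact (ae_restrict_iff' (measurableSet_ball.inter measurableSet_ball)).1 this

/-- The point of the circle of radius `ε` about the origin at angle `θ`. -/
noncomputable def circlePoint (ε θ : ℝ) : Plane := !₂[ε * Real.cos θ, ε * Real.sin θ]

/-- The polar angle of `x`, in `(-π, π]`. -/
noncomputable def polarAngle (x : Plane) : ℝ := Complex.arg ⟨x 0, x 1⟩

theorem circlePoint_mem_sphere {ε : ℝ} (hε : 0 < ε) (θ : ℝ) :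
    circlePoint ε θ ∈ sphere (0 : Plane) ε := by
  rw [mem_sphere_zero_iff_norm, EuclideanSpace.norm_eq,
    Real.sqrt_eq_iff_mul_self_eq (by positivity) hε.le]
  simp only [circlePoint, Fin.sum_univ_two, Real.norm_eq_abs, sq_abs]
  simp
  nlinarith [Real.sin_sq_add_cos_sq θ]

theorem polarAngle_circlePoint {ε θ : ℝ} (hε : 0 < ε) (hθ : θ ∈ Set.Ioc (-Real.pi) Real.pi) :
    polarAngle (circlePoint ε θ) = θ := by
  refine Eq.trans (congrArg Complex.arg ?_) (Complex.arg_mul_cos_add_sin_mul_I hε hθ)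
  apply Complex.ext <;> simp [circlePoint, ← Complex.ofReal_cos, ← Complex.ofReal_sin]

theorem circlePoint_polarAngle {ε : ℝ} (hε : 0 < ε) {x : Plane} (hx : x ∈ sphere (0 : Plane) ε) :
    circlePoint ε (polarAngle x) = x := by
  have hn : ‖(⟨x 0, x 1⟩ : ℂ)‖ = ε := by
    rw [mem_sphere_zero_iff_norm, EuclideanSpace.norm_eq, Fin.sum_univ_two] at hx
    rw [Complex.norm_def, ← hx]
    simp [Complex.normSq, sq]
  have hne : (⟨x 0, x 1⟩ : ℂ) ≠ 0 := by
    rw [← norm_pos_iff, hn]; exact hε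
  ext i
  fin_cases i
  · simp only [circlePoint, polarAngle, Complex.cos_arg hne, hn]; simp; field_simp
  · simp only [circlePoint, polarAngle, Complex.sin_arg, hn]; simp; field_simp

theorem lipschitzWith_circlePoint (ε : ℝ) (hε : 0 ≤ ε) :
    LipschitzWith ε.toNNReal (circlePoint ε) := by
  refine LipschitzWith.of_dist_le_mul fun a b => ?_
  rw [EuclideanSpace.dist_eq, Real.coe_toNNReal _ hε, Real.dist_eq]
  refine Real.sqrt_le_iff.2 ⟨by positivity, ?_⟩
  simp only [circlePoint, Fin.sum_univ_two, Real.dist_eq, sq_abs]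
  simp only [Matrix.cons_val_zero, Matrix.cons_val_one]
  have h1 : Real.cos (a - b) = _ := Real.cos_sub a b
  have h2 := Real.one_sub_sq_div_two_le_cos (x := a - b)
  have h3 : (ε * Real.cos a - ε * Real.cos b) ^ 2 + (ε * Real.sin a - ε * Real.sin b) ^ 2 =
      ε ^ 2 * (2 - 2 * Real.cos (a - b)) := by
    rw [h1]
    linear_combination ε ^ 2 * (Real.sin_sq_add_cos_sq a) + ε ^ 2 * (Real.sin_sq_add_cos_sq b)
  rw [h3, mul_pow, sq_abs]
  exact mul_le_mul_of_nonneg_left (by linarith) (sq_nonneg _)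

/-- An arc of a circle is at least as long as its projection onto the tangent at its midpoint. -/
theorem le_hausdorffMeasure_arc (ε m : ℝ) {h : ℝ} (hh : 0 ≤ h) :
    ENNReal.ofReal (2 * (ε * Real.sin h)) ≤
      μH[1] (circlePoint ε '' Set.Ioc (m - h) (m + h)) := by
  set p : Plane →L[ℝ] ℝ := innerSL ℝ (circlePoint 1 (m + Real.pi / 2)) with hp
  have hpv : ∀ θ, p (circlePoint ε θ) = ε * Real.sin (θ - m) := fun θ => by
    simp [hp, circlePoint, PiLp.inner_apply, Real.sin_sub, Real.cos_add, Real.sin_add]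
    ring
  have hpn : ‖p‖₊ = 1 := by
    rw [← NNReal.coe_inj, coe_nnnorm, hp, innerSL_apply_norm]
    exact mem_sphere_zero_iff_norm.1 (circlePoint_mem_sphere one_pos _)
  have h1 := p.lipschitz.hausdorffMeasure_image_le (d := 1) zero_le_one
    (circlePoint ε '' Set.Ioc (m - h) (m + h))
  rw [hpn, hausdorffMeasure_real] at h1
  simp only [ENNReal.coe_one, ENNReal.one_rpow, one_mul] at h1
  refine le_trans ?_ h1
  rw [Set.image_image]
  simp only [hpv]
  have hiv := intermediate_value_Ioc (f := fun θ => ε * Real.sin (θ - m)) (a := m - h) (b := m + h)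
    (by linarith) (by fun_prop)
  refine le_trans (le_of_eq ?_) (measure_mono hiv)
  simp only [Real.volume_Ioc]
  congr 1
  rw [show m - h - m = -h by ring, show m + h - m = h by ring, Real.sin_neg]
  ring

theorem hausdorffMeasure_sphere {ε : ℝ} (hε : 0 < ε) :
    μH[1] (sphere (0 : Plane) ε) = ENNReal.ofReal (2 * Real.pi * ε) := by
  have hπ := Real.pi_pos
  refine le_antisymm ?_ ?_
  · have hsub : sphere (0 : Plane) ε ⊆ circlePoint ε '' Set.Ioc (-Real.pi) Real.pi :=
      fun x hx => ⟨polarAngle x, Complex.arg_mem_Ioc _, circlePoint_polarAngle hε hx⟩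
    refine (measure_mono hsub).trans (((lipschitzWith_circlePoint ε hε.le).hausdorffMeasure_image_le
      zero_le_one _).trans (le_of_eq ?_))
    rw [hausdorffMeasure_real, Real.volume_Ioc, ENNReal.rpow_one, ← ENNReal.ofReal,
      ← ENNReal.ofReal_mul hε.le]
    congr 1; ring
  · have hmeas : Measurable polarAngle := by
      refine Complex.measurable_arg.comp ?_
      have : (fun x : Plane => (⟨x 0, x 1⟩ : ℂ)) = fun x => (x 0 : ℂ) + (x 1 : ℂ) * Complex.I := by
        funext x; apply Complex.ext <;> simp
      rw [this]
      fun_prop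
    have hbd : ∀ n : ℕ,
        ENNReal.ofReal ((n + 1 : ℕ) * (2 * (ε * Real.sin (Real.pi / (n + 1 : ℕ))))) ≤
        μH[1] (sphere (0 : Plane) ε) := by
      intro n
      set N : ℕ := n + 1 with hN
      have hNpos : (0 : ℝ) < N := by rw [hN]; positivity
      set h : ℝ := Real.pi / N with hh
      have hhpos : 0 < h := by positivity
      have hhN : h * N = Real.pi := by rw [hh]; field_simp
      set I : ℕ → Set ℝ := fun k =>
        Set.Ioc (-Real.pi + 2 * h * k) (-Real.pi + 2 * h * (k + 1)) with hI
      set A : ℕ → Set Plane := fun k => sphere (0 : Plane) ε ∩ polarAngle ⁻¹' I k with hA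
      have hdisj : ∀ i j : ℕ, i < j → Disjoint (I i) (I j) := by
        intro i j hij
        rw [Set.disjoint_left]
        rintro x ⟨-, hx⟩ ⟨hx', -⟩
        have : ((i : ℝ) + 1) ≤ j := by exact_mod_cast hij
        nlinarith
      have hdisjA : Set.PairwiseDisjoint (↑(Finset.range N)) A := by
        intro i _ j _ hij
        have hd : Disjoint (I i) (I j) := by
          rcases lt_or_gt_of_ne hij with h | h
          · exact hdisj i j h
          · exact (hdisj j i h).symm
        exact (hd.preimage polarAngle).mono Set.inter_subset_right Set.inter_subset_right
      have hsum := measure_biUnion_finset (μ := (μH[1] : Measure Plane)) hdisjA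
        (fun k _ => isClosed_sphere.measurableSet.inter (hmeas measurableSet_Ioc))
      have hle : ∑ k ∈ Finset.range N, ENNReal.ofReal (2 * (ε * Real.sin h)) ≤
          ∑ k ∈ Finset.range N, μH[1] (A k) := by
        refine Finset.sum_le_sum fun k hk => ?_
        refine (le_hausdorffMeasure_arc ε (-Real.pi + 2 * h * k + h) hhpos.le).trans
          (measure_mono ?_)
        rintro _ ⟨θ, ⟨hθ1, hθ2⟩, rfl⟩
        have hk' : ((k : ℝ) + 1) ≤ N := by exact_mod_cast Finset.mem_range.1 hk
        have hk0 : (0 : ℝ) ≤ k := k.cast_nonneg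
        have hθ : θ ∈ Set.Ioc (-Real.pi) Real.pi := ⟨by nlinarith, by nlinarith⟩
        refine ⟨circlePoint_mem_sphere hε θ, ?_⟩
        rw [Set.mem_preimage, polarAngle_circlePoint hε hθ]
        exact ⟨by linarith, by linarith⟩
      rw [← hsum, Finset.sum_const, Finset.card_range, nsmul_eq_mul] at hle
      rw [ENNReal.ofReal_mul hNpos.le, ENNReal.ofReal_natCast]
      exact hle.trans (measure_mono (Set.iUnion₂_subset fun k _ => Set.inter_subset_left))
    refine le_of_tendsto' (x := atTop) (f := fun n : ℕ => ENNReal.ofReal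
      ((n + 1 : ℕ) * (2 * (ε * Real.sin (Real.pi / (n + 1 : ℕ)))))) ?_ hbd
    refine ENNReal.tendsto_ofReal ?_
    have h0 : Tendsto (fun n : ℕ => Real.pi / (n + 1 : ℕ)) atTop (𝓝 0) :=
      (tendsto_const_div_atTop_nhds_zero_nat Real.pi).comp (tendsto_add_atTop_nat 1)
    have h1 := ((Real.continuous_sinc.tendsto 0).comp h0).const_mul (2 * Real.pi * ε)
    rw [Real.sinc_zero, mul_one] at h1
    refine h1.congr fun n => ?_
    have : (0 : ℝ) < (n + 1 : ℕ) := by positivity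
    rw [Function.comp_apply, Real.sinc_of_ne_zero (by positivity)]
    field_simp

/-! ### Functions of the form `x₁ F(|x|²)` -/

/-- The function `x ↦ x₁ F(|x|²)`. -/
noncomputable def radialField (F : ℝ → ℝ) (x : Plane) : ℝ := x 0 * F (‖x‖ ^ 2)

/-- The Kronecker symbol with real values. -/
def kron (i j : Fin 2) : ℝ := if i = j then 1 else 0

/-- The gradient of `x₁ F(|x|²)`, where `F₁` stands for `F'`. -/
noncomputable def radialGrad (F F₁ : ℝ → ℝ) (j : Fin 2) (x : Plane) : ℝ :=
  kron j 0 * F (‖x‖ ^ 2) + 2 * x 0 * x j * F₁ (‖x‖ ^ 2)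

/-- The Hessian of `x₁ F(|x|²)`, where `F₁` and `F₂` stand for `F'` and `F''`. -/
noncomputable def radialHess (F₁ F₂ : ℝ → ℝ) (i j : Fin 2) (x : Plane) : ℝ :=
  2 * (kron j 0 * x i + kron i 0 * x j + kron i j * x 0) * F₁ (‖x‖ ^ 2) +
    4 * x 0 * x i * x j * F₂ (‖x‖ ^ 2)

theorem norm_sq_eq (x : Plane) : ‖x‖ ^ 2 = x 0 ^ 2 + x 1 ^ 2 := by
  rw [EuclideanSpace.norm_sq_eq, Fin.sum_univ_two]
  simp

theorem sum_radialHess_diag (F₁ F₂ : ℝ → ℝ) (x : Plane) :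
    ∑ i, radialHess F₁ F₂ i i x =
      8 * x 0 * F₁ (‖x‖ ^ 2) + 4 * x 0 * ‖x‖ ^ 2 * F₂ (‖x‖ ^ 2) := by
  simp only [Fin.sum_univ_two, radialHess, kron]
  have h := norm_sq_eq x
  simp only [if_true, one_ne_zero, if_false]
  linear_combination (-4 * x 0 * F₂ (‖x‖ ^ 2)) * h

section LineDerivatives

variable {x : Plane} {i : Fin 2}

theorem hasLineDerivAt_coord (x : Plane) (i j : Fin 2) :
    HasLineDerivAt ℝ (fun y : Plane => y j) (kron i j) x (EuclideanSpace.single i 1) := by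
  have e : kron i j = (EuclideanSpace.proj j : Plane →L[ℝ] ℝ) (EuclideanSpace.single i 1) := by
    simp [kron, eq_comm]
  rw [e]
  exact (hasFDerivAt_coord j x).hasLineDerivAt _

theorem hasLineDerivAt_comp_normSq {F : ℝ → ℝ} {d : ℝ} (hF : HasDerivAt F d (‖x‖ ^ 2)) :
    HasLineDerivAt ℝ (fun y : Plane => F (‖y‖ ^ 2)) (d * (2 * x i)) x
      (EuclideanSpace.single i 1) := by
  have h := hF.comp_hasFDerivAt x (hasStrictFDerivAt_norm_sq x).hasFDerivAt
  have e : d * (2 * x i) = (d • 2 • innerSL ℝ x) (EuclideanSpace.single i 1) := by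
    simp [EuclideanSpace.inner_single_right]
  rw [e]
  exact h.hasLineDerivAt _

theorem hasLineDerivAt_mul {f k : Plane → ℝ} {f' k' : ℝ} {v : Plane}
    (hf : HasLineDerivAt ℝ f f' x v) (hk : HasLineDerivAt ℝ k k' x v) :
    HasLineDerivAt ℝ (fun y => f y * k y) (f' * k x + f x * k') x v := by
  have h := HasDerivAt.mul hf hk
  rw [zero_smul, add_zero] at h
  exact h

theorem hasLineDerivAt_radialField {F F₁ : ℝ → ℝ} (hF : HasDerivAt F (F₁ (‖x‖ ^ 2)) (‖x‖ ^ 2)) :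
    HasLineDerivAt ℝ (radialField F) (radialGrad F F₁ i x) x (EuclideanSpace.single i 1) := by
  have e : radialGrad F F₁ i x =
      kron i 0 * F (‖x‖ ^ 2) + x 0 * (F₁ (‖x‖ ^ 2) * (2 * x i)) := by
    simp only [radialGrad]; ring
  rw [e]
  exact hasLineDerivAt_mul (hasLineDerivAt_coord x i 0) (hasLineDerivAt_comp_normSq hF)

theorem hasLineDerivAt_radialGrad {F F₁ F₂ : ℝ → ℝ} {j : Fin 2}
    (hF : HasDerivAt F (F₁ (‖x‖ ^ 2)) (‖x‖ ^ 2)) (hF₁ : HasDerivAt F₁ (F₂ (‖x‖ ^ 2)) (‖x‖ ^ 2)) :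
    HasLineDerivAt ℝ (radialGrad F F₁ j) (radialHess F₁ F₂ i j x) x
      (EuclideanSpace.single i 1) := by
  have h1 := hasLineDerivAt_mul (hasLineDerivAt_mul (hasLineDerivAt_coord x i 0)
    (hasLineDerivAt_coord x i j)) (hasLineDerivAt_comp_normSq hF₁)
  have h2 : HasLineDerivAt ℝ (fun y : Plane => F (‖y‖ ^ 2)) _ x (EuclideanSpace.single i 1) :=
    hasLineDerivAt_comp_normSq hF
  have h3 := HasDerivAt.add (HasDerivAt.const_mul (kron j 0) h2) (HasDerivAt.const_mul 2 h1)
  have e : radialHess F₁ F₂ i j x = kron j 0 * (F₁ (‖x‖ ^ 2) * (2 * x i)) +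
      2 * ((kron i 0 * x j + x 0 * kron i j) * F₁ (‖x‖ ^ 2) +
        x 0 * x j * (F₂ (‖x‖ ^ 2) * (2 * x i))) := by
    simp only [radialHess]; ring
  have e' : radialGrad F F₁ j =
      fun y => kron j 0 * F (‖y‖ ^ 2) + 2 * (y 0 * y j * F₁ (‖y‖ ^ 2)) := by
    funext y; simp only [radialGrad]; ring
  rw [e, e']
  exact h3

end LineDerivatives

/-! ### Bounded Lipschitz functions -/

/-- `f` is bounded and Lipschitz on `s`. Unlike Lipschitz continuity alone, this is stable under
products. -/
def BddLipschitzOn {α : Type*} [PseudoMetricSpace α] (f : α → ℝ) (s : Set α) : Prop :=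
  (∃ K, LipschitzOnWith K f s) ∧ ∃ M, ∀ x ∈ s, |f x| ≤ M

section

variable {α β : Type*} [PseudoMetricSpace α] [PseudoMetricSpace β] {f k : α → ℝ} {s : Set α}

theorem BddLipschitzOn.const (c : ℝ) : BddLipschitzOn (fun _ : α => c) s :=
  ⟨⟨0, (LipschitzWith.const c).lipschitzOnWith⟩, |c|, fun _ _ => le_rfl⟩

theorem BddLipschitzOn.add (hf : BddLipschitzOn f s) (hk : BddLipschitzOn k s) :
    BddLipschitzOn (fun x => f x + k x) s := by
  obtain ⟨⟨K, hK⟩, M, hM⟩ := hf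
  obtain ⟨⟨L, hL⟩, N, hN⟩ := hk
  exact ⟨⟨K + L, hK.add hL⟩, M + N, fun x hx =>
    (abs_add_le _ _).trans (add_le_add (hM x hx) (hN x hx))⟩

theorem BddLipschitzOn.mul (hf : BddLipschitzOn f s) (hk : BddLipschitzOn k s) :
    BddLipschitzOn (fun x => f x * k x) s := by
  obtain ⟨⟨K, hK⟩, M, hM⟩ := hf
  obtain ⟨⟨L, hL⟩, N, hN⟩ := hk
  refine ⟨⟨M.toNNReal * L + N.toNNReal * K, LipschitzOnWith.of_dist_le_mul fun x hx y hy => ?_⟩,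
    M * N, fun x hx => ?_⟩
  · have h1 := hK.dist_le_mul x hx y hy
    have h2 := hL.dist_le_mul x hx y hy
    rw [Real.dist_eq] at h1 h2 ⊢
    have hM0 : 0 ≤ M := (abs_nonneg _).trans (hM x hx)
    have hN0 : 0 ≤ N := (abs_nonneg _).trans (hN x hx)
    push_cast
    rw [Real.coe_toNNReal _ hM0, Real.coe_toNNReal _ hN0]
    calc |f x * k x - f y * k y| = |f x * (k x - k y) + k y * (f x - f y)| := by ring_nf
      _ ≤ |f x| * |k x - k y| + |k y| * |f x - f y| := by
        rw [← abs_mul, ← abs_mul]; exact abs_add_le _ _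
      _ ≤ M * (L * dist x y) + N * (K * dist x y) := by
        gcongr
        · exact hM x hx
        · exact hN y hy
      _ = (M * L + N * K) * dist x y := by ring
  · rw [abs_mul]
    exact mul_le_mul (hM x hx) (hN x hx) (abs_nonneg _) ((abs_nonneg _).trans (hM x hx))

theorem BddLipschitzOn.comp {t : Set β} {F : ℝ → ℝ} {T : Set ℝ} {n : β → ℝ}
    (hF : BddLipschitzOn F T) (hn : BddLipschitzOn n t) (hmap : Set.MapsTo n t T) :
    BddLipschitzOn (fun x => F (n x)) t := by
  obtain ⟨⟨K, hK⟩, M, hM⟩ := hF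
  obtain ⟨⟨L, hL⟩, -⟩ := hn
  exact ⟨⟨K * L, hK.comp hL hmap⟩, M, fun x hx => hM _ (hmap hx)⟩

theorem bddLipschitzOn_of_isCompact {K : NNReal} (hs : IsCompact s) (hf : LipschitzOnWith K f s) :
    BddLipschitzOn f s := by
  obtain ⟨M, hM⟩ := hs.exists_bound_of_continuousOn hf.continuousOn
  exact ⟨⟨K, hf⟩, M, hM⟩

end

theorem bddLipschitzOn_of_hasDerivAt {F F₁ : ℝ → ℝ} {a b : ℝ}
    (hF : ∀ t ∈ Set.Icc a b, HasDerivAt F (F₁ t) t) (hF₁ : ContinuousOn F₁ (Set.Icc a b)) :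
    BddLipschitzOn F (Set.Icc a b) := by
  obtain ⟨M, hM⟩ := isCompact_Icc.exists_bound_of_continuousOn hF₁
  have : LipschitzOnWith M.toNNReal F (Set.Icc a b) :=
    (convex_Icc a b).lipschitzOnWith_of_nnnorm_hasDerivWithin_le
      (fun t ht => (hF t ht).hasDerivWithinAt) fun t ht => by
        rw [← NNReal.coe_le_coe, coe_nnnorm]
        exact (hM t ht).trans (Real.le_coe_toNNReal M)
  exact bddLipschitzOn_of_isCompact isCompact_Icc this

theorem bddLipschitzOn_coord (R : ℝ) (i : Fin 2) :
    BddLipschitzOn (fun x : Plane => x i) (ball 0 R) := by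
  refine ⟨⟨_, (EuclideanSpace.proj i : Plane →L[ℝ] ℝ).lipschitz.lipschitzOnWith⟩, R,
    fun x hx => (abs_coord_le_norm x i).trans (mem_ball_zero_iff.1 hx).le⟩

theorem bddLipschitzOn_normSq (R : ℝ) :
    BddLipschitzOn (fun x : Plane => ‖x‖ ^ 2) (ball 0 R) := by
  have h : BddLipschitzOn (fun x : Plane => ‖x‖) (ball 0 R) :=
    ⟨⟨1, lipschitzWith_one_norm.lipschitzOnWith⟩, R, fun x hx => by
      rw [abs_norm]; exact (mem_ball_zero_iff.1 hx).le⟩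
  simpa only [sq] using h.mul h

theorem normSq_mapsTo (R : ℝ) :
    Set.MapsTo (fun x : Plane => ‖x‖ ^ 2) (ball 0 R) (Set.Icc 0 (R ^ 2)) := fun x hx =>
  ⟨by positivity, pow_le_pow_left₀ (norm_nonneg x) (mem_ball_zero_iff.1 hx).le 2⟩

theorem ae_normSq_notMem {S : Set ℝ} (hS : S.Countable) : ∀ᵐ x : Plane, ‖x‖ ^ 2 ∉ S := by
  have h : volume (⋃ t ∈ S, sphere (0 : Plane) √t) = 0 :=
    (measure_biUnion_null_iff hS).2 fun t _ => Measure.addHaar_sphere volume 0 _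
  refine measure_mono_null (fun x hx => ?_) h
  have hx' : ‖x‖ ^ 2 ∈ S := not_not.1 hx
  refine Set.mem_biUnion hx' ?_
  rw [mem_sphere_zero_iff_norm, Real.sqrt_sq (norm_nonneg x)]

theorem memLp_of_bddLipschitzOn {R : ℝ} {f : Plane → ℝ} (hf : BddLipschitzOn f (ball 0 R)) :
    MemLp f 2 (volume.restrict (ball 0 R)) := by
  obtain ⟨⟨K, hK⟩, M, hM⟩ := hf
  have : IsFiniteMeasure (volume.restrict (ball (0 : Plane) R)) :=
    ⟨by rw [Measure.restrict_apply_univ]; exact measure_ball_lt_top⟩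
  refine MemLp.of_bound (hK.continuousOn.aestronglyMeasurable measurableSet_ball) M ?_
  filter_upwards [ae_restrict_mem measurableSet_ball] with x hx using hM x hx

/-- A profile `F` of class `C^{1,1}` makes `x₁ F(|x|²)` a function in `H²`, with the expected weak
derivatives. -/
theorem hasWeakHess_radialField {R : ℝ} {F F₁ F₂ : ℝ → ℝ} {S : Set ℝ} {K : NNReal}
    (hF : ∀ t, HasDerivAt F (F₁ t) t) (hL : LipschitzOnWith K F₁ (Set.Icc 0 (R ^ 2)))
    (hS : S.Countable) (hF₁ : ∀ t ∉ S, HasDerivAt F₁ (F₂ t) t) :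
    HasWeakHess (ball 0 R) (radialField F) (radialGrad F F₁) (radialHess F₁ F₂) := by
  have : IsFiniteMeasure (volume.restrict (ball (0 : Plane) R)) :=
    ⟨by rw [Measure.restrict_apply_univ]; exact measure_ball_lt_top⟩
  have b0 := (bddLipschitzOn_of_hasDerivAt (fun t _ => hF t) hL.continuousOn).comp
    (bddLipschitzOn_normSq R) (normSq_mapsTo R)
  have b1 := (bddLipschitzOn_of_isCompact isCompact_Icc hL).comp (bddLipschitzOn_normSq R)
    (normSq_mapsTo R)
  have bu : BddLipschitzOn (radialField F) (ball 0 R) := (bddLipschitzOn_coord R 0).mul b0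
  have bg : ∀ j, BddLipschitzOn (radialGrad F F₁ j) (ball 0 R) := fun j =>
    ((BddLipschitzOn.const _).mul b0).add ((((BddLipschitzOn.const 2).mul
      (bddLipschitzOn_coord R 0)).mul (bddLipschitzOn_coord R j)).mul b1)
  have wu : ∀ j, _ := fun j => isWeakPartial_of_lipschitzOnWith (i := j) isOpen_ball
    bu.1.choose_spec (ae_of_all _ fun x => hasLineDerivAt_radialField (hF _))
  have wg : ∀ i j, _ := fun i j => isWeakPartial_of_lipschitzOnWith (i := i)
    (g := radialHess F₁ F₂ i j) isOpen_ball (bg j).1.choose_spec <| ae_restrict_of_ae <| by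
      filter_upwards [ae_normSq_notMem hS] with x hx
      exact hasLineDerivAt_radialGrad (hF _) (hF₁ _ hx)
  exact ⟨memLp_of_bddLipschitzOn bu, fun j => (wu j).1, fun j => memLp_of_bddLipschitzOn (bg j),
    fun i j => (wg i j).1, fun i j => (wg i j).2.mono_exponent le_top⟩

/-! ### Membership of `x₁ F(|x|²)` in `H²₀` of a ball -/

/-- Bounded convergence in `L²` on a finite measure space. -/
theorem tendsto_eLpNorm_two_zero {α : Type*} [MeasurableSpace α] {μ : Measure α}
    [IsFiniteMeasure μ] {f : ℕ → α → ℝ} {M : ℝ} (hf : ∀ n, MemLp (f n) 2 μ)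
    (hM : ∀ n, ∀ᵐ x ∂μ, |f n x| ≤ M)
    (ht : ∀ᵐ x ∂μ, Tendsto (fun n => f n x) atTop (𝓝 0)) :
    Tendsto (fun n => eLpNorm (f n) 2 μ) atTop (𝓝 0) := by
  simp only [fun n => eLpNorm_two_eq_ofReal_sqrt (hf n)]
  have h : Tendsto (fun n => ∫ x, f n x ^ 2 ∂μ) atTop (𝓝 (∫ _, (0 : ℝ) ∂μ)) := by
    refine tendsto_integral_of_dominated_convergence (fun _ => M ^ 2)
      (fun n => (hf n).1.pow 2) (integrable_const _) (fun n => ?_) ?_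
    · filter_upwards [hM n] with x hx
      rw [Real.norm_eq_abs, abs_pow]
      exact pow_le_pow_left₀ (abs_nonneg _) hx 2
    · filter_upwards [ht] with x hx
      simpa using hx.pow 2
  rw [integral_zero] at h
  have h2 := (Real.continuous_sqrt.tendsto 0).comp h
  rw [Real.sqrt_zero] at h2
  simpa using ENNReal.tendsto_ofReal h2

theorem isFiniteMeasure_restrict_ball (R : ℝ) :
    IsFiniteMeasure (volume.restrict (ball (0 : Plane) R)) :=
  ⟨by rw [Measure.restrict_apply_univ]; exact measure_ball_lt_top⟩

theorem abs_kron_le (i j : Fin 2) : |kron i j| ≤ 1 := by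
  unfold kron; split_ifs <;> simp

theorem abs_coord_le {R : ℝ} {x : Plane} (hx : x ∈ ball (0 : Plane) R) (i : Fin 2) : |x i| ≤ R :=
  (abs_coord_le_norm x i).trans (mem_ball_zero_iff.1 hx).le

theorem tendsto_h2Norm_radialField {R M : ℝ} {F F₁ F₂ : ℕ → ℝ → ℝ}
    (H : ∀ n, HasWeakHess (ball 0 R) (radialField (F n)) (radialGrad (F n) (F₁ n))
      (radialHess (F₁ n) (F₂ n)))
    (hF : ∀ n, ∀ t ∈ Set.Icc 0 (R ^ 2), |F n t| ≤ M)
    (hF₁ : ∀ n, ∀ t ∈ Set.Icc 0 (R ^ 2), |F₁ n t| ≤ M)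
    (hF₂ : ∀ n, ∀ t ∈ Set.Icc 0 (R ^ 2), |F₂ n t| ≤ M)
    (t0 : ∀ t ∈ Set.Icc 0 (R ^ 2), Tendsto (fun n => F n t) atTop (𝓝 0))
    (t1 : ∀ t ∈ Set.Icc 0 (R ^ 2), Tendsto (fun n => F₁ n t) atTop (𝓝 0))
    (t2 : ∀ t ∈ Set.Icc 0 (R ^ 2), Tendsto (fun n => F₂ n t) atTop (𝓝 0)) :
    Tendsto (fun n => h2Norm (ball 0 R) (radialField (F n))) atTop (𝓝 0) := by
  have := isFiniteMeasure_restrict_ball R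
  have hmem : ∀ᵐ x ∂(volume.restrict (ball (0 : Plane) R)), x ∈ ball (0 : Plane) R :=
    ae_restrict_mem measurableSet_ball
  simp only [fun n => (H n).h2Norm_eq isOpen_ball]
  have e0 : Tendsto (fun n => eLpNorm (radialField (F n)) 2 (volume.restrict (ball 0 R))) atTop
      (𝓝 0) := by
    refine tendsto_eLpNorm_two_zero (M := R * M) (fun n => (H n).memLp) (fun n => ?_) ?_
    · filter_upwards [hmem] with x hx
      have hxi := abs_coord_le hx
      have hR : 0 ≤ R := (abs_nonneg _).trans (hxi 0)
      rw [radialField, abs_mul]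
      gcongr
      · exact hxi 0
      · exact hF n _ (normSq_mapsTo R hx)
    · filter_upwards [hmem] with x hx
      simpa [radialField] using (t0 _ (normSq_mapsTo R hx)).const_mul (x 0)
  have e1 : ∀ j, Tendsto (fun n => eLpNorm (radialGrad (F n) (F₁ n) j) 2
      (volume.restrict (ball 0 R))) atTop (𝓝 0) := by
    intro j
    refine tendsto_eLpNorm_two_zero (M := 1 * M + 2 * R * R * M) (fun n => (H n).memLp_grad j)
      (fun n => ?_) ?_
    · filter_upwards [hmem] with x hx
      have hxi := abs_coord_le hx
      have hR : 0 ≤ R := (abs_nonneg _).trans (hxi 0)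
      refine (abs_add_le _ _).trans ?_
      simp only [abs_mul, abs_two]
      gcongr
      · exact abs_kron_le _ _
      · exact hF n _ (normSq_mapsTo R hx)
      · exact hxi 0
      · exact hxi j
      · exact hF₁ n _ (normSq_mapsTo R hx)
    · filter_upwards [hmem] with x hx
      simpa [radialGrad] using ((t0 _ (normSq_mapsTo R hx)).const_mul (kron j 0)).add
        ((t1 _ (normSq_mapsTo R hx)).const_mul (2 * x 0 * x j))
  have e2 : ∀ i j, Tendsto (fun n => eLpNorm (radialHess (F₁ n) (F₂ n) i j) 2
      (volume.restrict (ball 0 R))) atTop (𝓝 0) := by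
    intro i j
    refine tendsto_eLpNorm_two_zero (M := 2 * (1 * R + 1 * R + 1 * R) * M + 4 * R * R * R * M)
      (fun n => (H n).memLp_hess i j) (fun n => ?_) ?_
    · filter_upwards [hmem] with x hx
      have hxi := abs_coord_le hx
      have hR : 0 ≤ R := (abs_nonneg _).trans (hxi 0)
      have hsum : |kron j 0 * x i + kron i 0 * x j + kron i j * x 0| ≤ 1 * R + 1 * R + 1 * R := by
        refine (abs_add_three _ _ _).trans ?_
        simp only [abs_mul]
        gcongr <;> first | exact abs_kron_le _ _ | exact hxi _
      refine (abs_add_le _ _).trans ?_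
      rw [abs_mul, abs_mul, abs_mul, abs_mul, abs_mul, abs_mul, abs_two,
        abs_of_pos (show (0 : ℝ) < 4 by norm_num)]
      gcongr
      · exact hF₁ n _ (normSq_mapsTo R hx)
      · exact hxi 0
      · exact hxi i
      · exact hxi j
      · exact hF₂ n _ (normSq_mapsTo R hx)
    · filter_upwards [hmem] with x hx
      simpa [radialHess] using ((t1 _ (normSq_mapsTo R hx)).const_mul
        (2 * (kron j 0 * x i + kron i 0 * x j + kron i j * x 0))).add
        ((t2 _ (normSq_mapsTo R hx)).const_mul (4 * x 0 * x i * x j))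
  have := (e0.add (tendsto_finsetSum Finset.univ fun j _ => e1 j)).add
    (tendsto_finsetSum Finset.univ fun i _ => tendsto_finsetSum Finset.univ fun j _ => e2 i j)
  simpa using this

theorem isTestFunction_radialField {R b : ℝ} {G : ℝ → ℝ} (hR : 0 < R) (hG : ContDiff ℝ ∞ G)
    (hb : b < R ^ 2) (hz : ∀ t, b ≤ t → G t = 0) :
    IsTestFunction (ball 0 R) (radialField G) := by
  have hts : tsupport (radialField G) ⊆ closedBall 0 √b := by
    refine closure_minimal (fun x hx => ?_) isClosed_closedBall
    rw [mem_closedBall_zero_iff]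
    by_contra! hlt
    refine hx ?_
    rw [radialField, hz _ ((Real.sqrt_lt' ((Real.sqrt_nonneg b).trans_lt hlt)).1 hlt).le, mul_zero]
  refine ⟨?_, ?_, hts.trans ?_⟩
  · refine ContDiff.mul ?_ (hG.comp (contDiff_norm_sq ℝ))
    exact (EuclideanSpace.proj 0 : Plane →L[ℝ] ℝ).contDiff
  · exact (isCompact_closedBall 0 √b).of_isClosed_subset (isClosed_tsupport _) hts
  · exact closedBall_subset_ball ((Real.sqrt_lt' hR).2 hb)

/-- Smooth cutoffs exhausting an open interval. -/
theorem exists_cutoff {a b : ℝ} (hab : a < b) :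
    ∃ χ : ℕ → ℝ → ℝ, (∀ n, ContDiff ℝ ∞ (χ n)) ∧ (∀ n t, |χ n t| ≤ 1) ∧
      (∀ n, tsupport (χ n) ⊆ Set.Ioo a b) ∧ (∀ n, ∃ c < b, ∀ t, c ≤ t → χ n t = 0) ∧
      ∀ t ∈ Set.Ioo a b, Tendsto (fun n => χ n t) atTop (𝓝 1) := by
  set m := (a + b) / 2 with hm
  set h := (b - a) / 2 with hh
  have hpos : 0 < h := by rw [hh]; linarith
  have hin : ∀ n : ℕ, 1 / ((n : ℝ) + 2) < 1 := fun n => by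
    rw [div_lt_one (by positivity)]; linarith [(n.cast_nonneg : (0 : ℝ) ≤ n)]
  let B : ℕ → ContDiffBump m := fun n =>
    { rIn := h * (1 - 1 / ((n : ℝ) + 2))
      rOut := h * (1 - 1 / ((n : ℝ) + 3))
      rIn_pos := mul_pos hpos (by linarith [hin n])
      rIn_lt_rOut := by
        refine mul_lt_mul_of_pos_left ?_ hpos
        have : 1 / ((n : ℝ) + 3) < 1 / ((n : ℝ) + 2) :=
          one_div_lt_one_div_of_lt (by positivity) (by linarith)
        linarith }
  have hout : ∀ n, (B n).rOut < h := fun n => by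
    have : 0 < 1 / ((n : ℝ) + 3) := by positivity
    change h * (1 - 1 / ((n : ℝ) + 3)) < h
    nlinarith
  refine ⟨fun n => B n, fun n => (B n).contDiff, fun n t => ?_, fun n => ?_, fun n => ?_, ?_⟩
  · rw [abs_of_nonneg (B n).nonneg]; exact (B n).le_one
  · rw [(B n).tsupport_eq, Real.closedBall_eq_Icc]
    intro t ht
    have := hout n
    exact ⟨by linarith [ht.1], by linarith [ht.2]⟩
  · refine ⟨m + (B n).rOut, by linarith [hout n], fun t ht => (B n).zero_of_le_dist ?_⟩
    rw [Real.dist_eq]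
    exact (by linarith : (B n).rOut ≤ t - m).trans (le_abs_self _)
  · intro t ht
    have hlt : |t - m| < h := abs_lt.2 ⟨by linarith [ht.1], by linarith [ht.2]⟩
    have hlim : Tendsto (fun n : ℕ => h * (1 - 1 / ((n : ℝ) + 2))) atTop (𝓝 (h * (1 - 0))) := by
      refine (tendsto_const_nhds.sub ?_).const_mul h
      have := (tendsto_const_div_atTop_nhds_zero_nat (1 : ℝ)).comp (tendsto_add_atTop_nat 2)
      refine this.congr fun n => ?_
      simp
    rw [sub_zero, mul_one] at hlim
    refine tendsto_const_nhds.congr' ?_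
    filter_upwards [hlim.eventually (lt_mem_nhds hlt)] with n hn
    exact ((B n).one_of_mem_closedBall (by rw [mem_closedBall, Real.dist_eq]; exact hn.le)).symm

theorem abs_intervalIntegral_le {f : ℝ → ℝ} {M b t : ℝ} (hf : ∀ t ∈ Set.Icc 0 b, |f t| ≤ M)
    (ht : t ∈ Set.Icc 0 b) : |∫ s in b..t, f s| ≤ M * b := by
  have hM : 0 ≤ M := (abs_nonneg _).trans (hf t ht)
  have h := intervalIntegral.norm_integral_le_of_norm_le_const (f := f) (a := b) (b := t) (C := M)
    fun s hs => by
      rw [Set.uIoc_of_ge ht.2] at hs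
      exact hf s ⟨ht.1.trans hs.1.le, hs.2⟩
  refine h.trans ?_
  gcongr
  rw [abs_le]
  exact ⟨by linarith [ht.1], by linarith [ht.1, ht.2]⟩

theorem tendsto_intervalIntegral_of_bounded {f : ℝ → ℝ} {k : ℕ → ℝ → ℝ} {M b t : ℝ}
    (hc : ∀ n, Continuous (k n)) (hk : ∀ n, ∀ t ∈ Set.Icc 0 b, |k n t| ≤ M)
    (hlim : ∀ t ∈ Set.Icc 0 b, Tendsto (fun n => k n t) atTop (𝓝 (f t)))
    (ht : t ∈ Set.Icc 0 b) :
    Tendsto (fun n => ∫ s in b..t, k n s) atTop (𝓝 (∫ s in b..t, f s)) := by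
  have hs : ∀ s ∈ Set.uIoc b t, s ∈ Set.Icc 0 b := fun s hs => by
    rw [Set.uIoc_of_ge ht.2] at hs
    exact ⟨ht.1.trans hs.1.le, hs.2⟩
  refine intervalIntegral.tendsto_integral_filter_of_dominated_convergence (fun _ => M)
    (Eventually.of_forall fun n => (hc n).aestronglyMeasurable)
    (Eventually.of_forall fun n => ae_of_all _ fun s h => hk n s (hs s h))
    intervalIntegrable_const (ae_of_all _ fun s h => hlim s (hs s h))

theorem contDiff_intervalIntegral {f : ℝ → ℝ} (hf : ContDiff ℝ ∞ f) (b : ℝ) :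
    ContDiff ℝ ∞ fun t => ∫ s in b..t, f s := by
  have hd : ∀ t, HasDerivAt (fun t => ∫ s in b..t, f s) (f t) t := fun t =>
    (hf.continuous.integral_hasStrictDerivAt b t).hasDerivAt
  refine contDiff_infty_iff_deriv.2 ⟨fun t => (hd t).differentiableAt, ?_⟩
  rwa [show deriv (fun t => ∫ s in b..t, f s) = f from funext fun t => (hd t).deriv]

theorem intervalIntegral_eq_zero_of_le {f : ℝ → ℝ} {b c : ℝ} (hcb : c < b)
    (hf : ∀ t, c ≤ t → f t = 0) (t : ℝ) (ht : c ≤ t) : ∫ s in b..t, f s = 0 := by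
  refine intervalIntegral.integral_zero_ae (ae_of_all _ fun s hs => hf s ?_)
  exact (le_min hcb.le ht).trans hs.1.le

/-- A `C^{1,1}` profile whose second derivative lives on an interval `(a, R²)` and which
vanishes to first order at `R²`, gives an element of `H²₀(B_R)`. The approximating test
functions have as profiles the second antiderivatives of smooth truncations of `F''`. -/
theorem memH20_radialField {R a M : ℝ} (hR : 0 < R) (haR : a < R ^ 2)
    {F F₁ F₂ : ℝ → ℝ} {K : NNReal} (hF : ∀ t, HasDerivAt F (F₁ t) t)
    (hL : LipschitzOnWith K F₁ (Set.Icc 0 (R ^ 2))) (hc : Continuous F₁)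
    (hF₁ : ∀ t ∉ ({a, R ^ 2} : Set ℝ), HasDerivAt F₁ (F₂ t) t)
    (hs : ContDiffOn ℝ ∞ F₂ (Set.Ioo a (R ^ 2))) (hz : ∀ t ∉ Set.Ioo a (R ^ 2), F₂ t = 0)
    (hM : ∀ t, |F₂ t| ≤ M) (hFR : F (R ^ 2) = 0) (hF₁R : F₁ (R ^ 2) = 0) :
    MemH20 (ball 0 R) (radialField F) := by
  set b := R ^ 2 with hb
  have hb0 : 0 ≤ b := sq_nonneg R
  have hcount : ({a, b} : Set ℝ).Countable := (Set.toFinite _).countable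
  have H := hasWeakHess_radialField hF hL hcount hF₁
  obtain ⟨χ, χs, χ1, χt, χ0, χl⟩ := exists_cutoff haR
  set G₂ : ℕ → ℝ → ℝ := fun n t => χ n t * F₂ t with hG₂
  set G₁ : ℕ → ℝ → ℝ := fun n t => ∫ s in b..t, G₂ n s with hG₁
  set G : ℕ → ℝ → ℝ := fun n t => ∫ s in b..t, G₁ n s with hG
  have sG₂ : ∀ n, ContDiff ℝ ∞ (G₂ n) := fun n => contDiff_iff_contDiffAt.2 fun t => by
    by_cases ht : t ∈ tsupport (χ n)
    · exact (χs n).contDiffAt.mul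
        ((hs t (χt n ht)).contDiffAt (isOpen_Ioo.mem_nhds (χt n ht)))
    · refine (contDiffAt_const (c := (0 : ℝ))).congr_of_eventuallyEq ?_
      filter_upwards [notMem_tsupport_iff_eventuallyEq.1 ht] with r hr
      simp [hG₂, hr]
  have sG₁ : ∀ n, ContDiff ℝ ∞ (G₁ n) := fun n => contDiff_intervalIntegral (sG₂ n) b
  have sG : ∀ n, ContDiff ℝ ∞ (G n) := fun n => contDiff_intervalIntegral (sG₁ n) b
  have dG₁ : ∀ n t, HasDerivAt (G₁ n) (G₂ n t) t := fun n t =>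
    ((sG₂ n).continuous.integral_hasStrictDerivAt b t).hasDerivAt
  have dG : ∀ n t, HasDerivAt (G n) (G₁ n t) t := fun n t =>
    ((sG₁ n).continuous.integral_hasStrictDerivAt b t).hasDerivAt
  have test : ∀ n, IsTestFunction (ball 0 R) (radialField (G n)) := fun n => by
    obtain ⟨c, hc, hcz⟩ := χ0 n
    refine isTestFunction_radialField hR (sG n) hc (intervalIntegral_eq_zero_of_le hc
      (intervalIntegral_eq_zero_of_le hc fun t ht => ?_))
    simp only [hG₂, hcz t ht, zero_mul]
  have l2 : ∀ t, Tendsto (fun n => G₂ n t) atTop (𝓝 (F₂ t)) := fun t => by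
    by_cases ht : t ∈ Set.Ioo a b
    · simpa using (χl t ht).mul_const (F₂ t)
    · simp [hG₂, hz t ht]
  have bG₂ : ∀ n t, |G₂ n t| ≤ M := fun n t => by
    rw [hG₂, abs_mul]
    exact (mul_le_of_le_one_left (abs_nonneg _) (χ1 n t)).trans (hM t)
  have mF₂ : AEStronglyMeasurable F₂ (volume : Measure ℝ) :=
    aestronglyMeasurable_of_tendsto_ae atTop
      (fun n => (sG₂ n).continuous.aestronglyMeasurable) (ae_of_all _ l2)
  have iF₂ : ∀ t, IntervalIntegrable F₂ volume b t := fun t =>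
    (intervalIntegrable_const (c := M)).mono_fun mF₂.restrict
      (ae_of_all _ fun s => (hM s).trans (le_abs_self M))
  have eF₁ : ∀ t, F₁ t = ∫ s in b..t, F₂ s := fun t => by
    rw [MeasureTheory.integral_eq_of_hasDerivAt_off_countable F₁ F₂ hcount hc.continuousOn
      (fun s hs => hF₁ s hs.2) (iF₂ t), hF₁R, sub_zero]
  have eF : ∀ t, F t = ∫ s in b..t, F₁ s := fun t => by
    rw [intervalIntegral.integral_eq_sub_of_hasDerivAt (fun s _ => hF s)
      (hc.intervalIntegrable _ _), hFR, sub_zero]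
  have bG₁ : ∀ n, ∀ t ∈ Set.Icc 0 b, |G₁ n t| ≤ M * b := fun n t ht =>
    abs_intervalIntegral_le (fun s _ => bG₂ n s) ht
  have bG : ∀ n, ∀ t ∈ Set.Icc 0 b, |G n t| ≤ M * b * b := fun n t ht =>
    abs_intervalIntegral_le (bG₁ n) ht
  have bF₁ : ∀ t ∈ Set.Icc 0 b, |F₁ t| ≤ M * b := fun t ht => by
    rw [eF₁]; exact abs_intervalIntegral_le (fun s _ => hM s) ht
  have bF : ∀ t ∈ Set.Icc 0 b, |F t| ≤ M * b * b := fun t ht => by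
    rw [eF]; exact abs_intervalIntegral_le bF₁ ht
  have l1 : ∀ t ∈ Set.Icc 0 b, Tendsto (fun n => G₁ n t) atTop (𝓝 (F₁ t)) := fun t ht => by
    rw [eF₁]
    exact tendsto_intervalIntegral_of_bounded (fun n => (sG₂ n).continuous)
      (fun n s _ => bG₂ n s) (fun s _ => l2 s) ht
  have l0 : ∀ t ∈ Set.Icc 0 b, Tendsto (fun n => G n t) atTop (𝓝 (F t)) := fun t ht => by
    rw [eF]
    exact tendsto_intervalIntegral_of_bounded (fun n => (sG₁ n).continuous) bG₁ l1 ht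
  refine ⟨H.memH2, fun n => radialField (G n), test, ?_⟩
  have hsub : ∀ n, (fun x => radialField F x - radialField (G n) x) =
      radialField (fun t => F t - G n t) := fun n => by
    funext x; simp only [radialField]; ring
  simp only [hsub]
  have hM0 : 0 ≤ M := (abs_nonneg _).trans (hM 0)
  have hLG : ∀ n, ∃ L, LipschitzOnWith L (G₁ n) (Set.Icc 0 b) := fun n =>
    (bddLipschitzOn_of_hasDerivAt (fun t _ => dG₁ n t) (sG₂ n).continuous.continuousOn).1
  have h1 : 0 ≤ M * b := by positivity
  have h2 : 0 ≤ M * b * b := by positivity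
  have hd : ∀ {x y c : ℝ}, |x| ≤ c → |y| ≤ c → |x - y| ≤ 2 * c := fun hx hy => by
    linarith [abs_sub _ _ |>.trans (add_le_add hx hy)]
  refine tendsto_h2Norm_radialField (M := 2 * (M * b * b + M * b + M))
    (F₁ := fun n t => F₁ t - G₁ n t) (F₂ := fun n t => F₂ t - G₂ n t) (fun n => ?_)
    (fun n t ht => (hd (bF t ht) (bG n t ht)).trans (by linarith))
    (fun n t ht => (hd (bF₁ t ht) (bG₁ n t ht)).trans (by linarith))
    (fun n t ht => (hd (hM t) (bG₂ n t)).trans (by linarith))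
    (fun t ht => ?_) (fun t ht => ?_) (fun t _ => ?_)
  · obtain ⟨L, hLn⟩ := hLG n
    exact hasWeakHess_radialField (fun t => (hF t).sub (dG n t)) (hL.sub hLn) hcount
      fun t ht => (hF₁ t ht).sub (dG₁ n t)
  · simpa using (l0 t ht).const_sub (F t)
  · simpa using (l1 t ht).const_sub (F₁ t)
  · simpa using (l2 t).const_sub (F₂ t)

/-! ### The profile of the minimizer -/

/-- Composing with a `1`-Lipschitz map `c` preserves the derivative wherever `c` is locally the
identity, and wherever the derivative vanishes. -/
theorem hasDerivAt_comp_of_lipschitzWith {f c : ℝ → ℝ} {d t : ℝ} (hc : LipschitzWith 1 c)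
    (hf : HasDerivAt f d (c t)) (h : c =ᶠ[𝓝 t] id ∨ d = 0) : HasDerivAt (fun s => f (c s)) d t := by
  rcases h with h | rfl
  · have hct : c t = t := h.eq_of_nhds
    rw [hct] at hf
    exact hf.congr_of_eventuallyEq (h.fun_comp f)
  · rw [hasDerivAt_iff_isLittleO] at hf ⊢
    simp only [smul_zero, sub_zero] at hf ⊢
    refine (hf.comp_tendsto hc.continuous.continuousAt).trans_isBigO ?_
    refine Asymptotics.IsBigO.of_bound 1 (Eventually.of_forall fun s => ?_)
    simpa [dist_eq_norm] using hc.dist_le_mul s t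

section Profile

variable (k ε R : ℝ)

/-- The radial profile of the minimizer in the annulus, as a function of `t = |x|²`, up to the
factor `k`. -/
noncomputable def annulusProfile (t : ℝ) : ℝ :=
  k * (coeffAlpha ε R + coeffBeta ε R * (1 / t) + coeffGamma ε R * t + 2 * Real.log t)

/-- The first derivative of `annulusProfile`. -/
noncomputable def annulusProfileD (t : ℝ) : ℝ :=
  k * (coeffBeta ε R * (-1 / t ^ 2) + coeffGamma ε R + 2 * (1 / t))

/-- The second derivative of `annulusProfile`. -/
noncomputable def annulusProfileDD (t : ℝ) : ℝ :=
  k * (coeffBeta ε R * (2 / t ^ 3) + 2 * (-1 / t ^ 2))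

variable {k ε R}

theorem hasDerivAt_one_div {t : ℝ} (ht : t ≠ 0) :
    HasDerivAt (fun t : ℝ => 1 / t) (-1 / t ^ 2) t := by
  simpa [div_eq_mul_inv] using hasDerivAt_inv ht

theorem hasDerivAt_neg_one_div_sq {t : ℝ} (ht : t ≠ 0) :
    HasDerivAt (fun t : ℝ => -1 / t ^ 2) (2 / t ^ 3) t := by
  have h := ((hasDerivAt_const t (-1 : ℝ)).div (hasDerivAt_pow 2 t) (pow_ne_zero 2 ht))
  refine h.congr_deriv ?_
  field_simp
  norm_num
  ring

theorem hasDerivAt_annulusProfile {t : ℝ} (ht : t ≠ 0) :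
    HasDerivAt (annulusProfile k ε R) (annulusProfileD k ε R t) t := by
  have h := ((((hasDerivAt_one_div ht).const_mul (coeffBeta ε R)).const_add (coeffAlpha ε R)).add
    ((hasDerivAt_id t).const_mul (coeffGamma ε R))).add ((Real.hasDerivAt_log ht).const_mul 2)
  refine (h.const_mul k).congr_deriv ?_
  simp only [annulusProfileD]
  ring

theorem hasDerivAt_annulusProfileD {t : ℝ} (ht : t ≠ 0) :
    HasDerivAt (annulusProfileD k ε R) (annulusProfileDD k ε R t) t := by
  have h := (((hasDerivAt_neg_one_div_sq ht).const_mul (coeffBeta ε R)).add_const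
    (coeffGamma ε R)).add ((hasDerivAt_one_div ht).const_mul 2)
  exact h.const_mul k

theorem annulusProfileD_inner (hε : 0 < ε) (hR : 0 < R) : annulusProfileD k ε R (ε ^ 2) = 0 := by
  simp only [annulusProfileD, coeffBeta, coeffGamma]
  field_simp
  ring

theorem annulusProfileD_outer (hR : 0 < R) : annulusProfileD k ε R (R ^ 2) = 0 := by
  have : 0 < R ^ 2 + ε ^ 2 := by positivity
  simp only [annulusProfileD, coeffBeta, coeffGamma]
  field_simp
  ring

theorem annulusProfile_outer (hR : 0 < R) : annulusProfile k ε R (R ^ 2) = 0 := by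
  have : 0 < R ^ 2 + ε ^ 2 := by positivity
  simp only [annulusProfile, coeffAlpha, coeffBeta, coeffGamma]
  field_simp
  ring

variable (ε R) in
/-- The retraction of the line onto `[ε², R²]`. -/
noncomputable def clampSq (t : ℝ) : ℝ := max (ε ^ 2) (min (R ^ 2) t)

theorem lipschitzWith_clampSq : LipschitzWith 1 (clampSq ε R) :=
  (LipschitzWith.id.const_min (R ^ 2)).const_max (ε ^ 2)

theorem clampSq_of_le {t : ℝ} (ht : t ≤ ε ^ 2) : clampSq ε R t = ε ^ 2 :=
  max_eq_left ((min_le_right _ _).trans ht)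

theorem clampSq_of_ge (h : ε ^ 2 ≤ R ^ 2) {t : ℝ} (ht : R ^ 2 ≤ t) : clampSq ε R t = R ^ 2 := by
  rw [clampSq, min_eq_left ht, max_eq_right h]

theorem clampSq_of_mem {t : ℝ} (ht : t ∈ Set.Icc (ε ^ 2) (R ^ 2)) : clampSq ε R t = t := by
  rw [clampSq, min_eq_right ht.2, max_eq_right ht.1]

theorem clampSq_mem (h : ε ^ 2 ≤ R ^ 2) (t : ℝ) : clampSq ε R t ∈ Set.Icc (ε ^ 2) (R ^ 2) :=
  ⟨le_max_left _ _, max_le h (min_le_left _ _)⟩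

variable (k ε R) in
/-- The profile of the minimizer extended to all of `ℝ`: since the derivative vanishes at both
ends of `[ε², R²]`, the constant extensions are of class `C^{1,1}`. -/
noncomputable def dipoleProfile (t : ℝ) : ℝ := annulusProfile k ε R (clampSq ε R t)

variable (k ε R) in
/-- The derivative of `dipoleProfile`. -/
noncomputable def dipoleProfileD (t : ℝ) : ℝ := annulusProfileD k ε R (clampSq ε R t)

variable (k ε R) in
/-- The second derivative of `dipoleProfile` outside `ε²` and `R²`. -/
noncomputable def dipoleProfileDD : ℝ → ℝ :=
  (Set.Ioo (ε ^ 2) (R ^ 2)).indicator (annulusProfileDD k ε R)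

theorem trichotomy_of_notMem {a b t : ℝ} (ht : t ∉ ({a, b} : Set ℝ)) :
    t < a ∨ b < t ∨ t ∈ Set.Ioo a b := by
  simp only [Set.mem_insert_iff, Set.mem_singleton_iff, not_or] at ht
  rcases lt_or_gt_of_ne ht.1 with h | h
  · exact Or.inl h
  · rcases lt_or_gt_of_ne ht.2 with h' | h'
    · exact Or.inr (Or.inr ⟨h, h'⟩)
    · exact Or.inr (Or.inl h')

theorem sq_lt_sq_radii (hε : 0 < ε) (hεR : ε < R) : ε ^ 2 < R ^ 2 :=
  pow_lt_pow_left₀ hεR hε.le two_ne_zero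

theorem clampSq_ne_zero (hε : 0 < ε) (hεR : ε < R) (t : ℝ) : clampSq ε R t ≠ 0 :=
  ((pow_pos hε 2).trans_le (clampSq_mem (sq_lt_sq_radii hε hεR).le t).1).ne'

theorem hasDerivAt_dipoleProfile (hε : 0 < ε) (hεR : ε < R) (t : ℝ) :
    HasDerivAt (dipoleProfile k ε R) (dipoleProfileD k ε R t) t := by
  have hlt := sq_lt_sq_radii hε hεR
  refine hasDerivAt_comp_of_lipschitzWith (c := clampSq ε R) lipschitzWith_clampSq
    (hasDerivAt_annulusProfile (clampSq_ne_zero hε hεR t)) ?_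
  rcases le_or_gt t (ε ^ 2) with h | h
  · exact Or.inr (by rw [dipoleProfileD, clampSq_of_le h, annulusProfileD_inner hε (hε.trans hεR)])
  rcases le_or_gt (R ^ 2) t with h' | h'
  · exact Or.inr (by rw [dipoleProfileD, clampSq_of_ge hlt.le h',
      annulusProfileD_outer (hε.trans hεR)])
  · refine Or.inl ?_
    filter_upwards [Ioo_mem_nhds h h'] with s hs
    exact clampSq_of_mem (Set.Ioo_subset_Icc_self hs)

theorem hasDerivAt_dipoleProfileD (hε : 0 < ε) (hεR : ε < R) {t : ℝ}
    (ht : t ∉ ({ε ^ 2, R ^ 2} : Set ℝ)) :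
    HasDerivAt (dipoleProfileD k ε R) (dipoleProfileDD k ε R t) t := by
  have hlt := sq_lt_sq_radii hε hεR
  rcases trichotomy_of_notMem ht with h | h | h
  · have hz : dipoleProfileDD k ε R t = 0 := Set.indicator_of_notMem (fun h' => h.not_gt h'.1) _
    rw [hz]
    refine (hasDerivAt_const t (annulusProfileD k ε R (ε ^ 2))).congr_of_eventuallyEq ?_
    filter_upwards [Iio_mem_nhds h] with s hs
    rw [dipoleProfileD, clampSq_of_le (le_of_lt hs)]
  · have hz : dipoleProfileDD k ε R t = 0 := Set.indicator_of_notMem (fun h' => h.not_gt h'.2) _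
    rw [hz]
    refine (hasDerivAt_const t (annulusProfileD k ε R (R ^ 2))).congr_of_eventuallyEq ?_
    filter_upwards [Ioi_mem_nhds h] with s hs
    rw [dipoleProfileD, clampSq_of_ge hlt.le (le_of_lt hs)]
  · rw [dipoleProfileDD, Set.indicator_of_mem h]
    refine (hasDerivAt_annulusProfileD ((pow_pos hε 2).trans h.1).ne').congr_of_eventuallyEq ?_
    filter_upwards [Ioo_mem_nhds h.1 h.2] with s hs
    rw [dipoleProfileD, clampSq_of_mem (Set.Ioo_subset_Icc_self hs)]

theorem contDiffOn_annulusProfileDD (hε : 0 < ε) :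
    ContDiffOn ℝ ∞ (annulusProfileDD k ε R) (Set.Icc (ε ^ 2) (R ^ 2)) := by
  intro t ht
  have ht0 : t ≠ 0 := ((pow_pos hε 2).trans_le ht.1).ne'
  refine ContDiffAt.contDiffWithinAt ?_
  unfold annulusProfileDD
  have h3 : ContDiffAt ℝ ∞ (fun t : ℝ => 2 / t ^ 3) t :=
    contDiffAt_const.div (contDiffAt_id.pow 3) (pow_ne_zero 3 ht0)
  have h2 : ContDiffAt ℝ ∞ (fun t : ℝ => -1 / t ^ 2) t :=
    contDiffAt_const.div (contDiffAt_id.pow 2) (pow_ne_zero 2 ht0)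
  exact contDiffAt_const.mul ((contDiffAt_const.mul h3).add (contDiffAt_const.mul h2))

theorem exists_lipschitzWith_dipoleProfileD (hε : 0 < ε) (hεR : ε < R) :
    ∃ K : NNReal, LipschitzWith K (dipoleProfileD k ε R) := by
  have hlt := sq_lt_sq_radii hε hεR
  obtain ⟨⟨K, hK⟩, -⟩ := bddLipschitzOn_of_hasDerivAt (a := ε ^ 2) (b := R ^ 2)
    (fun t ht => hasDerivAt_annulusProfileD (k := k) (ε := ε) (R := R)
      ((pow_pos hε 2).trans_le ht.1).ne') (contDiffOn_annulusProfileDD hε).continuousOn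
  refine ⟨K * 1, lipschitzOnWith_univ.1 ?_⟩
  exact hK.comp lipschitzWith_clampSq.lipschitzOnWith fun t _ => clampSq_mem hlt.le t

theorem hasWeakHess_dipoleProfile (hε : 0 < ε) (hεR : ε < R) :
    HasWeakHess (ball 0 R) (radialField (dipoleProfile k ε R))
    (radialGrad (dipoleProfile k ε R) (dipoleProfileD k ε R))
    (radialHess (dipoleProfileD k ε R) (dipoleProfileDD k ε R)) := by
  obtain ⟨K, hK⟩ := exists_lipschitzWith_dipoleProfileD (k := k) hε hεR
  exact hasWeakHess_radialField (hasDerivAt_dipoleProfile hε hεR) hK.lipschitzOnWith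
    (Set.toFinite _).countable fun t ht => hasDerivAt_dipoleProfileD hε hεR ht

theorem memH20_dipoleProfile (hε : 0 < ε) (hεR : ε < R) :
    MemH20 (ball 0 R) (radialField (dipoleProfile k ε R)) := by
  have hlt := sq_lt_sq_radii hε hεR
  obtain ⟨K, hK⟩ := exists_lipschitzWith_dipoleProfileD (k := k) hε hεR
  have hs := contDiffOn_annulusProfileDD (k := k) (R := R) hε
  obtain ⟨M, hM⟩ := isCompact_Icc.exists_bound_of_continuousOn hs.continuousOn
  refine memH20_radialField (M := M) (hε.trans hεR) hlt (hasDerivAt_dipoleProfile hε hεR)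
    hK.lipschitzOnWith hK.continuous (fun t ht => hasDerivAt_dipoleProfileD hε hεR ht) ?_
    (fun t ht => Set.indicator_of_notMem ht _) (fun t => ?_) ?_ ?_
  · exact (hs.mono Set.Ioo_subset_Icc_self).congr fun t ht => Set.indicator_of_mem ht _
  · by_cases ht : t ∈ Set.Ioo (ε ^ 2) (R ^ 2)
    · rw [dipoleProfileDD, Set.indicator_of_mem ht]
      exact hM t (Set.Ioo_subset_Icc_self ht)
    · rw [dipoleProfileDD, Set.indicator_of_notMem ht, abs_zero]
      exact (norm_nonneg _).trans (hM _ (Set.left_mem_Icc.2 hlt.le))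
  · rw [dipoleProfile, clampSq_of_ge hlt.le le_rfl, annulusProfile_outer (hε.trans hεR)]
  · rw [dipoleProfileD, clampSq_of_ge hlt.le le_rfl, annulusProfileD_outer (hε.trans hεR)]

/-- The Laplacian of the minimizer in the annulus. -/
theorem laplacian_dipoleProfile (hε : 0 < ε) {x : Plane} (hx : ‖x‖ ^ 2 ∈ Set.Ioo (ε ^ 2) (R ^ 2)) :
    ∑ i, radialHess (dipoleProfileD k ε R) (dipoleProfileDD k ε R) i i x =
      8 * k * (x 0 * (coeffGamma ε R + 1 / ‖x‖ ^ 2)) := by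
  have ht : ‖x‖ ^ 2 ≠ 0 := ((pow_pos hε 2).trans hx.1).ne'
  rw [sum_radialHess_diag, dipoleProfileD, dipoleProfileDD, Set.indicator_of_mem hx,
    clampSq_of_mem (Set.Ioo_subset_Icc_self hx), annulusProfileD, annulusProfileDD]
  generalize ‖x‖ ^ 2 = t at *
  field_simp
  ring

end Profile

/-! ### A `C^{1,1}` continuation of `x₁ / |x|²` to the disc -/

section Continuation

variable (γ a : ℝ)

/-- The profile `γ + 1/t` for `t ≥ a`, continued below `a` by its tangent at `a`. -/
noncomputable def tangentProfile (t : ℝ) : ℝ :=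
  γ + (1 / max a t + max a t / a ^ 2) - t / a ^ 2

/-- The derivative of `tangentProfile`. -/
noncomputable def tangentProfileD (t : ℝ) : ℝ := -1 / max a t ^ 2

/-- The second derivative of `tangentProfile` outside `a`. -/
noncomputable def tangentProfileDD : ℝ → ℝ := (Set.Ioi a).indicator fun t => 2 / t ^ 3

variable {γ a}

theorem max_ne_zero (ha : 0 < a) (t : ℝ) : max a t ≠ 0 := (ha.trans_le (le_max_left a t)).ne'

theorem hasDerivAt_tangentProfile (ha : 0 < a) (t : ℝ) :
    HasDerivAt (tangentProfile γ a) (tangentProfileD a t) t := by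
  have h1 : HasDerivAt (fun m : ℝ => 1 / m + m / a ^ 2) (-1 / max a t ^ 2 + 1 / a ^ 2)
      (max a t) := (hasDerivAt_one_div (max_ne_zero ha t)).add ((hasDerivAt_id _).div_const _)
  have h2 := hasDerivAt_comp_of_lipschitzWith (c := fun t => max a t)
    (LipschitzWith.id.const_max a) h1 ?_
  · refine ((h2.const_add γ).sub ((hasDerivAt_id t).div_const (a ^ 2))).congr_deriv ?_
    simp only [tangentProfileD]; ring
  · rcases le_or_gt t a with h | h
    · right; rw [max_eq_left h]; ring
    · left
      filter_upwards [Ioi_mem_nhds h] with s hs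
      exact max_eq_right (le_of_lt hs)

theorem hasDerivAt_tangentProfileD (ha : 0 < a) {t : ℝ} (ht : t ∉ ({a} : Set ℝ)) :
    HasDerivAt (tangentProfileD a) (tangentProfileDD a t) t := by
  rcases lt_or_gt_of_ne ht with h | h
  · have hz : tangentProfileDD a t = 0 := Set.indicator_of_notMem (fun h' => h.not_gt h') _
    rw [hz]
    refine (hasDerivAt_const t (-1 / a ^ 2)).congr_of_eventuallyEq ?_
    filter_upwards [Iio_mem_nhds h] with s hs
    rw [tangentProfileD, max_eq_left (le_of_lt hs)]
  · rw [tangentProfileDD, Set.indicator_of_mem (show t ∈ Set.Ioi a from h)]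
    refine (hasDerivAt_neg_one_div_sq (ha.trans h).ne').congr_of_eventuallyEq ?_
    filter_upwards [Ioi_mem_nhds h] with s hs
    rw [tangentProfileD, max_eq_right (le_of_lt hs)]

theorem hasWeakHess_tangentProfile (ha : 0 < a) {R : ℝ} (haR : a ≤ R ^ 2) :
    HasWeakHess (ball 0 R) (radialField (tangentProfile γ a))
      (radialGrad (tangentProfile γ a) (tangentProfileD a))
      (radialHess (tangentProfileD a) (tangentProfileDD a)) := by
  have hne : ∀ t ∈ Set.Icc a (R ^ 2), t ≠ 0 := fun t ht => (ha.trans_le ht.1).ne'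
  obtain ⟨⟨K, hK⟩, -⟩ := bddLipschitzOn_of_hasDerivAt (a := a) (b := R ^ 2)
    (fun t ht => hasDerivAt_neg_one_div_sq (hne t ht))
    (continuousOn_const.div (continuousOn_pow 3) fun t ht => pow_ne_zero 3 (hne t ht))
  refine hasWeakHess_radialField (hasDerivAt_tangentProfile ha)
    (hK.comp (LipschitzWith.id.const_max a).lipschitzOnWith fun t ht => ⟨le_max_left a t,
      max_le haR ht.2⟩) (Set.toFinite {a}).countable
    fun t ht => hasDerivAt_tangentProfileD ha ht

theorem radialField_tangentProfile {x : Plane} (hx : a ≤ ‖x‖ ^ 2) :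
    radialField (tangentProfile γ a) x = x 0 * (γ + 1 / ‖x‖ ^ 2) := by
  rw [radialField, tangentProfile, max_eq_right hx]
  ring

/-- The continuation is harmonic outside the disc `|x|² ≤ a`. -/
theorem laplacian_tangentProfile_outer (ha : 0 < a) {x : Plane} (hx : a < ‖x‖ ^ 2) :
    ∑ i, radialHess (tangentProfileD a) (tangentProfileDD a) i i x = 0 := by
  have ht : ‖x‖ ^ 2 ≠ 0 := (ha.trans hx).ne'
  rw [sum_radialHess_diag, tangentProfileD, tangentProfileDD,
    Set.indicator_of_mem (show ‖x‖ ^ 2 ∈ Set.Ioi a from hx), max_eq_right hx.le]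
  generalize ‖x‖ ^ 2 = t at *
  field_simp
  ring

theorem laplacian_tangentProfile_inner {x : Plane} (hx : ‖x‖ ^ 2 < a) :
    ∑ i, radialHess (tangentProfileD a) (tangentProfileDD a) i i x = -8 / a ^ 2 * x 0 := by
  rw [sum_radialHess_diag, tangentProfileD, tangentProfileDD,
    Set.indicator_of_notMem (fun h : ‖x‖ ^ 2 ∈ Set.Ioi a => hx.not_gt h), max_eq_left hx.le]
  ring

end Continuation

/-! ### Quadratic moments of the disc -/

/-- The quarter turn of the plane. -/
noncomputable def quarterTurn : Plane ≃ₗᵢ[ℝ] Plane where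
  toFun x := !₂[-x 1, x 0]
  invFun x := !₂[x 1, -x 0]
  left_inv x := by ext i; fin_cases i <;> simp
  right_inv x := by ext i; fin_cases i <;> simp
  map_add' x y := by ext i; fin_cases i <;> simp; ring
  map_smul' c x := by ext i; fin_cases i <;> simp
  norm_map' x := by
    rw [← sq_eq_sq₀ (norm_nonneg _) (norm_nonneg _), norm_sq_eq, norm_sq_eq]
    simp
    ring

theorem setIntegral_ball_comp_quarterTurn (f : Plane → ℝ) (ε : ℝ) :
    ∫ x in ball 0 ε, f (quarterTurn x) = ∫ x in ball 0 ε, f x := by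
  have h := quarterTurn.measurePreserving.setIntegral_preimage_emb
    quarterTurn.toHomeomorph.measurableEmbedding f (ball 0 ε)
  rw [← h]
  congr 2
  ext x
  simp

theorem integrableOn_ball_of_continuous {f : Plane → ℝ} (hf : Continuous f) (ε : ℝ) :
    IntegrableOn f (ball 0 ε) :=
  (hf.continuousOn.integrableOn_compact (isCompact_closedBall 0 ε)).mono_set ball_subset_closedBall

theorem setIntegral_normSq_ball {ε : ℝ} (hε : 0 ≤ ε) :
    ∫ x in ball (0 : Plane) ε, ‖x‖ ^ 2 = Real.pi * ε ^ 4 / 2 := by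
  have h := integral_fun_norm_addHaar (volume : Measure Plane)
    ((Set.Iio ε).indicator fun r : ℝ => r ^ 2)
  have e1 : ∫ x : Plane, (Set.Iio ε).indicator (fun r : ℝ => r ^ 2) ‖x‖ =
      ∫ x in ball (0 : Plane) ε, ‖x‖ ^ 2 := by
    rw [← integral_indicator measurableSet_ball]
    refine integral_congr_ae (ae_of_all _ fun x => ?_)
    by_cases hx : ‖x‖ < ε <;> simp [Set.indicator, hx]
  have e2 : ∫ y in Set.Ioi (0 : ℝ), y ^ (Module.finrank ℝ Plane - 1) •
      (Set.Iio ε).indicator (fun r : ℝ => r ^ 2) y = ε ^ 4 / 4 := by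
    have e3 : ∀ y : ℝ, y ^ (Module.finrank ℝ Plane - 1) •
        (Set.Iio ε).indicator (fun r : ℝ => r ^ 2) y =
        (Set.Iio ε).indicator (fun r : ℝ => r ^ 3) y := fun y => by
      by_cases hy : y < ε <;> simp [Set.indicator, hy]
      ring
    simp only [e3]
    rw [setIntegral_indicator measurableSet_Iio, Set.Ioi_inter_Iio,
      ← integral_Ioc_eq_integral_Ioo, ← intervalIntegral.integral_of_le hε, integral_pow]
    norm_num
  have e4 : (volume : Measure Plane).real (ball 0 1) = Real.pi := by
    rw [Measure.real, EuclideanSpace.volume_ball_fin_two]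
    simp [Real.pi_pos.le]
  rw [e1, e2, e4] at h
  rw [h]
  simp
  ring

/-- Pairing an affine function with `x₁` over a centred disc sees only its `x₁`-coefficient. -/
theorem setIntegral_coord_mul_affine {ε : ℝ} (hε : 0 ≤ ε) (c₀ c₁ c₂ : ℝ) :
    ∫ x in ball (0 : Plane) ε, x 0 * (c₀ + c₁ * x 0 + c₂ * x 1) = c₁ * (Real.pi * ε ^ 4 / 4) := by
  have hi : ∀ f : Plane → ℝ, Continuous f → IntegrableOn f (ball 0 ε) := fun f hf =>
    integrableOn_ball_of_continuous hf ε
  have m0 : ∫ x in ball (0 : Plane) ε, x 0 = 0 := by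
    have h1 := setIntegral_ball_comp_quarterTurn (fun x => x 0) ε
    have h2 := setIntegral_ball_comp_quarterTurn (fun x => x 1) ε
    simp only [quarterTurn, LinearIsometryEquiv.coe_mk, LinearEquiv.coe_mk] at h1 h2
    simp [integral_neg] at h1 h2
    linarith
  have m01 : ∫ x in ball (0 : Plane) ε, x 0 * x 1 = 0 := by
    have h1 := setIntegral_ball_comp_quarterTurn (fun x => x 0 * x 1) ε
    simp [quarterTurn, integral_neg] at h1
    have h2 : ∫ x in ball (0 : Plane) ε, x 1 * x 0 = ∫ x in ball (0 : Plane) ε, x 0 * x 1 := by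
      simp only [mul_comm]
    linarith
  have m00 : ∫ x in ball (0 : Plane) ε, x 0 ^ 2 = Real.pi * ε ^ 4 / 4 := by
    have h1 := setIntegral_ball_comp_quarterTurn (fun x => x 0 ^ 2) ε
    simp [quarterTurn] at h1
    have h2 := setIntegral_normSq_ball hε
    simp only [norm_sq_eq] at h2
    rw [integral_add (hi _ (by fun_prop)) (hi _ (by fun_prop)), h1] at h2
    linarith
  have e : ∀ x : Plane, x 0 * (c₀ + c₁ * x 0 + c₂ * x 1) =
      c₀ * x 0 + c₁ * x 0 ^ 2 + c₂ * (x 0 * x 1) := fun x => by ring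
  simp only [e]
  rw [integral_add (hi _ (by fun_prop)) (hi _ (by fun_prop)),
    integral_add (hi _ (by fun_prop)) (hi _ (by fun_prop)), integral_const_mul, integral_const_mul,
    integral_const_mul, m0, m01, m00]
  ring

/-! ### Functions that are affine in the disc -/

section

variable {Ω : Set Plane} {u v w : Plane → ℝ} {g g' : Fin 2 → Plane → ℝ}
  {h h' : Fin 2 → Fin 2 → Plane → ℝ}

theorem HasWeakHess.congr (H : HasWeakHess Ω u g h) (huv : u =ᵐ[volume.restrict Ω] v) :
    HasWeakHess Ω v g h :=
  ⟨H.memLp.ae_eq huv, fun j => (H.isWeakPartial j).congr huv Filter.EventuallyEq.rfl,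
    H.memLp_grad, H.isWeakPartial_grad, H.memLp_hess⟩

theorem MemH20.congr (hΩ : IsOpen Ω) (hu : MemH20 Ω u) (huv : u =ᵐ[volume.restrict Ω] v) :
    MemH20 Ω v := by
  have H := hu.1.hasWeakHess hΩ
  obtain ⟨-, φ, hφ, ht⟩ := hu
  refine ⟨(H.congr huv).memH2, φ, hφ, ht.congr fun n => ?_⟩
  have Hn := H.sub ((hφ n).hasWeakHess hΩ)
  have hn : (fun x => u x - φ n x) =ᵐ[volume.restrict Ω] fun x => v x - φ n x := by
    filter_upwards [huv] with x hx
    rw [hx]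
  rw [Hn.h2Norm_eq hΩ, (Hn.congr hn).h2Norm_eq hΩ, eLpNorm_congr_ae hn]

theorem isWeakPartial_affine (ε c₀ c₁ c₂ : ℝ) (j : Fin 2) :
    IsWeakPartial (ball 0 ε) j (fun x : Plane => c₀ + c₁ * x 0 + c₂ * x 1)
      (fun _ => c₁ * kron j 0 + c₂ * kron j 1) := by
  have hb : BddLipschitzOn (fun x : Plane => c₀ + c₁ * x 0 + c₂ * x 1) (ball 0 ε) :=
    ((BddLipschitzOn.const c₀).add ((BddLipschitzOn.const c₁).mul (bddLipschitzOn_coord ε 0))).add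
      ((BddLipschitzOn.const c₂).mul (bddLipschitzOn_coord ε 1))
  refine (isWeakPartial_of_lipschitzOnWith isOpen_ball hb.1.choose_spec
    (ae_of_all _ fun x => ?_)).1
  exact HasDerivAt.add (HasDerivAt.const_add c₀ (HasDerivAt.const_mul c₁
    (hasLineDerivAt_coord x j 0))) (HasDerivAt.const_mul c₂ (hasLineDerivAt_coord x j 1))

variable {ε c₀ c₁ c₂ : ℝ}

theorem HasWeakHess.grad_of_affine (H : HasWeakHess Ω w g h) (hε : ball 0 ε ⊆ Ω)
    (hw : ∀ᵐ x : Plane ∂(volume.restrict (ball 0 ε)), w x = c₀ + c₁ * x 0 + c₂ * x 1)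
    (j : Fin 2) :
    g j =ᵐ[volume.restrict (ball 0 ε)] fun _ => c₁ * kron j 0 + c₂ * kron j 1 :=
  (((H.isWeakPartial j).mono hε).congr hw Filter.EventuallyEq.rfl).ae_eq isOpen_ball
    (isWeakPartial_affine ε c₀ c₁ c₂ j)

theorem HasWeakHess.hess_of_affine (H : HasWeakHess Ω w g h) (hε : ball 0 ε ⊆ Ω)
    (hw : ∀ᵐ x : Plane ∂(volume.restrict (ball 0 ε)), w x = c₀ + c₁ * x 0 + c₂ * x 1)
    (i j : Fin 2) : h i j =ᵐ[volume.restrict (ball 0 ε)] fun _ => 0 := by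
  have h0 := isWeakPartial_affine ε (c₁ * kron j 0 + c₂ * kron j 1) 0 0 i
  simp only [zero_mul, add_zero] at h0
  exact (((H.isWeakPartial_grad i j).mono hε).congr (H.grad_of_affine hε hw j)
    Filter.EventuallyEq.rfl).ae_eq isOpen_ball h0

theorem dipoleFunctional_eq {E ν s R : ℝ} (hε : 0 < ε) (hεR : ε < R)
    (H : HasWeakHess (ball 0 R) w g h)
    (hw : ∀ᵐ x : Plane ∂(volume.restrict (ball 0 ε)), w x = c₀ + c₁ * x 0 + c₂ * x 1) :
    dipoleFunctional E ν s ε R w = elasticEnergy E ν (ball 0 R) w + s * c₁ := by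
  have hsub : ball (0 : Plane) ε ⊆ ball 0 R := ball_subset_ball hεR.le
  have hg : ∀ᵐ x ∂(volume.restrict (ball (0 : Plane) ε)), weakPartial (ball 0 R) 0 w x = c₁ := by
    have h1 := ae_restrict_of_ae_restrict_of_subset hsub (H.weakPartial_ae isOpen_ball 0)
    filter_upwards [h1, H.grad_of_affine hsub hw 0] with x hx hx'
    rw [hx, hx']
    simp [kron]
  have hint : ∫ x in sphere (0 : Plane) ε,
      boundaryTrace (ball 0 ε) (weakPartial (ball 0 R) 0 w) x ∂(μH[1]) =
      2 * Real.pi * ε * c₁ := by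
    rw [setIntegral_congr_fun (g := fun _ => c₁) isClosed_sphere.measurableSet
      fun x hx => boundaryTrace_eq_const hg hε hx, setIntegral_const, Measure.real,
      hausdorffMeasure_sphere hε, ENNReal.toReal_ofReal (by positivity), smul_eq_mul]
  have hπ := Real.pi_pos
  rw [dipoleFunctional, hint]
  field_simp

/-! ### The quadratic form of the energy -/

/-- The bilinear form `∇²u : ∇²v - ν Δu Δv` in terms of the Hessians `h` of `u` and `h'` of `v`. -/
def hessForm (ν : ℝ) (h h' : Fin 2 → Fin 2 → Plane → ℝ) (x : Plane) : ℝ :=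
  (∑ i, ∑ j, h i j x * h' i j x) - ν * ((∑ i, h i i x) * ∑ j, h' j j x)

theorem HasWeakHess.memLp_laplacian (H : HasWeakHess Ω u g h) :
    MemLp (fun x => ∑ i, h i i x) 2 (volume.restrict Ω) :=
  memLp_finsetSum _ fun i _ => H.memLp_hess i i

theorem HasWeakHess.integrable_hess_mul (H : HasWeakHess Ω u g h) (H' : HasWeakHess Ω v g' h')
    (i j k l : Fin 2) : Integrable (fun x => h i j x * h' k l x) (volume.restrict Ω) :=
  (H.memLp_hess i j).integrable_mul (H'.memLp_hess k l)

theorem HasWeakHess.integrable_inner (H : HasWeakHess Ω u g h) (H' : HasWeakHess Ω v g' h') :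
    Integrable (fun x => ∑ i, ∑ j, h i j x * h' i j x) (volume.restrict Ω) :=
  integrable_finsetSum _ fun i _ => integrable_finsetSum _ fun j _ =>
    H.integrable_hess_mul H' i j i j

theorem HasWeakHess.integrable_laplacian_mul (H : HasWeakHess Ω u g h)
    (H' : HasWeakHess Ω v g' h') :
    Integrable (fun x => (∑ i, h i i x) * ∑ j, h' j j x) (volume.restrict Ω) :=
  H.memLp_laplacian.integrable_mul H'.memLp_laplacian

theorem HasWeakHess.integrable_hessForm (ν : ℝ) (H : HasWeakHess Ω u g h)
    (H' : HasWeakHess Ω v g' h') : Integrable (hessForm ν h h') (volume.restrict Ω) :=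
  (H.integrable_inner H').sub ((H.integrable_laplacian_mul H').const_mul ν)

theorem HasWeakHess.integral_hessForm (ν : ℝ) (hΩ : IsOpen Ω) (H : HasWeakHess Ω u g h)
    (hv : MemH20 Ω v) (H' : HasWeakHess Ω v g' h') :
    ∫ x in Ω, hessForm ν h h' x = (1 - ν) * ∫ x in Ω, (∑ i, h i i x) * ∑ j, h' j j x := by
  have e1 : ∫ x in Ω, ∑ i, ∑ j, h i j x * h' i j x = ∑ i, ∑ j, ∫ x in Ω, h i j x * h' i j x := by
    rw [integral_finsetSum _ fun i _ => integrable_finsetSum _ fun j _ =>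
      H.integrable_hess_mul H' i j i j]
    exact Finset.sum_congr rfl fun i _ => integral_finsetSum _ fun j _ =>
      H.integrable_hess_mul H' i j i j
  have e2 : ∫ x in Ω, (∑ i, h i i x) * ∑ j, h' j j x =
      ∑ i, ∑ j, ∫ x in Ω, h i i x * h' j j x := by
    simp only [Finset.sum_mul_sum]
    rw [integral_finsetSum _ fun i _ => integrable_finsetSum _ fun j _ =>
      H.integrable_hess_mul H' i i j j]
    exact Finset.sum_congr rfl fun i _ => integral_finsetSum _ fun j _ =>
      H.integrable_hess_mul H' i i j j
  simp only [hessForm]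
  rw [integral_sub (H.integrable_inner H') ((H.integrable_laplacian_mul H').const_mul ν),
    integral_const_mul, e1, H.integral_hess_inner hΩ hv H', ← e2]
  ring

theorem HasWeakHess.elasticEnergy_eq (E ν : ℝ) (hΩ : IsOpen Ω) (H : HasWeakHess Ω u g h) :
    elasticEnergy E ν Ω u = 1 / 2 * ((1 + ν) / E) * ∫ x in Ω, hessForm ν h h x := by
  unfold elasticEnergy
  congr 1
  refine integral_congr_ae ?_
  have hall : ∀ᵐ x ∂(volume.restrict Ω), ∀ i j, weakHess Ω i j u x = h i j x :=
    ae_all_iff.2 fun i => ae_all_iff.2 fun j => H.weakHess_ae hΩ i j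
  filter_upwards [hall] with x hx
  simp only [hx, hessForm, sq]

/-- The form is positive definite for `ν < 1/2`, because `(Δu)² ≤ 2 |∇²u|²`. -/
theorem le_hessForm_self {ν : ℝ} (hν : ν < 1 / 2) (h : Fin 2 → Fin 2 → Plane → ℝ) (x : Plane) :
    min 1 (1 - 2 * ν) * h 0 0 x ^ 2 ≤ hessForm ν h h x := by
  simp only [hessForm, Fin.sum_univ_two]
  set a := h 0 0 x
  set b := h 0 1 x
  set c := h 1 0 x
  set d := h 1 1 x
  rcases le_or_gt 0 ν with h0 | h0
  · rw [min_eq_right (by linarith)]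
    nlinarith [mul_nonneg h0 (sq_nonneg (a - d)), mul_nonneg (sub_pos.2 hν).le (sq_nonneg d),
      sq_nonneg b, sq_nonneg c]
  · rw [min_eq_left (by linarith)]
    nlinarith [mul_nonneg (neg_pos.2 h0).le (sq_nonneg (a + d)), sq_nonneg b, sq_nonneg c,
      sq_nonneg d]

theorem integral_hessForm_expand (ν : ℝ) (H : HasWeakHess Ω u g h) (H' : HasWeakHess Ω v g' h') :
    ∫ x in Ω, hessForm ν h h x =
      (∫ x in Ω, hessForm ν h' h' x) +
        2 * (∫ x in Ω, hessForm ν h' (fun i j x => h i j x - h' i j x) x) +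
        ∫ x in Ω, hessForm ν (fun i j x => h i j x - h' i j x)
          (fun i j x => h i j x - h' i j x) x := by
  have Hd := H.sub H'
  have i1 : Integrable (fun x => 2 * hessForm ν h' (fun i j x => h i j x - h' i j x) x)
      (volume.restrict Ω) := (H'.integrable_hessForm ν Hd).const_mul 2
  have i2 : Integrable (fun x => hessForm ν h' h' x +
      2 * hessForm ν h' (fun i j x => h i j x - h' i j x) x) (volume.restrict Ω) :=
    (H'.integrable_hessForm ν H').add i1
  rw [← integral_const_mul, ← integral_add (H'.integrable_hessForm ν H') i1,
    ← integral_add i2 (Hd.integrable_hessForm ν Hd)]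
  refine integral_congr_ae (ae_of_all _ fun x => ?_)
  simp only [hessForm, Fin.sum_univ_two]
  ring

end

/-! ### The Euler–Lagrange equation -/

section EulerLagrange

variable {k ε R c₀ c₁ c₂ : ℝ} {w : Plane → ℝ} {g : Fin 2 → Plane → ℝ}
  {h : Fin 2 → Fin 2 → Plane → ℝ}

/-- Weak form of the Euler–Lagrange equation. In the annulus `ΔW` is a multiple of the harmonic
function `x₁ (γ + 1/|x|²)`. As `Δw` vanishes in the disc, `ΔW` may be replaced there by any
`C^{1,1}` continuation, and two integrations by parts leave an integral over the disc only, where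
`w` is affine. -/
theorem integral_laplacian_dipole_mul (hε : 0 < ε) (hεR : ε < R) (hw20 : MemH20 (ball 0 R) w)
    (H : HasWeakHess (ball 0 R) w g h)
    (hw : ∀ᵐ x : Plane ∂(volume.restrict (ball 0 ε)), w x = c₀ + c₁ * x 0 + c₂ * x 1) :
    ∫ x in ball (0 : Plane) R,
      (∑ i, radialHess (dipoleProfileD k ε R) (dipoleProfileDD k ε R) i i x) * ∑ j, h j j x =
      -(16 * Real.pi * k * c₁) := by
  have hlt := sq_lt_sq_radii hε hεR
  have ha : 0 < ε ^ 2 := pow_pos hε 2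
  have hsub : ball (0 : Plane) ε ⊆ ball 0 R := ball_subset_ball hεR.le
  set T := tangentProfile (coeffGamma ε R) (ε ^ 2) with hT
  have HT := hasWeakHess_tangentProfile (γ := coeffGamma ε R) ha hlt.le
  have hess0 : ∀ᵐ x : Plane, x ∈ ball (0 : Plane) ε → ∀ j, h j j x = 0 :=
    (ae_restrict_iff' measurableSet_ball).1 (ae_all_iff.2 fun j => H.hess_of_affine hsub hw j j)
  have hwae := (ae_restrict_iff' measurableSet_ball).1 hw
  have hne : ∀ᵐ x : Plane, ‖x‖ ^ 2 ∉ ({ε ^ 2} : Set ℝ) :=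
    ae_normSq_notMem (Set.countable_singleton _)
  have hball : ∀ x : Plane, ‖x‖ ^ 2 < ε ^ 2 ↔ x ∈ ball (0 : Plane) ε := fun x => by
    rw [mem_ball_zero_iff, sq_lt_sq₀ (norm_nonneg x) hε.le]
  have hcase : ∀ x : Plane, ‖x‖ ^ 2 ∉ ({ε ^ 2} : Set ℝ) →
      x ∈ ball (0 : Plane) ε ∨ (ε ^ 2 < ‖x‖ ^ 2 ∧ x ∉ ball (0 : Plane) ε) := fun x hx => by
    rcases lt_or_gt_of_ne (fun e => hx e : ‖x‖ ^ 2 ≠ ε ^ 2) with h1 | h1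
    · exact Or.inl ((hball x).1 h1)
    · exact Or.inr ⟨h1, fun h2 => h1.not_gt ((hball x).2 h2)⟩
  -- replace `ΔW` by the continuation
  have e1 : ∫ x in ball (0 : Plane) R,
      (∑ i, radialHess (dipoleProfileD k ε R) (dipoleProfileDD k ε R) i i x) * ∑ j, h j j x =
      8 * k * ∫ x in ball (0 : Plane) R, ∑ j, radialField T x * h j j x := by
    rw [← integral_const_mul]
    refine integral_congr_ae ?_
    filter_upwards [ae_restrict_of_ae hess0, ae_restrict_of_ae hne,
      ae_restrict_mem measurableSet_ball] with x h0 hx hxR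
    rw [← Finset.mul_sum, ← mul_assoc]
    rcases hcase x hx with hx | ⟨hx, -⟩
    · simp [h0 hx]
    · have hxR' : ‖x‖ ^ 2 < R ^ 2 :=
        pow_lt_pow_left₀ (mem_ball_zero_iff.1 hxR) (norm_nonneg x) two_ne_zero
      rw [laplacian_dipoleProfile hε ⟨hx, hxR'⟩, radialField_tangentProfile hx.le]
  have e2 : ∫ x in ball (0 : Plane) R, ∑ j, radialField T x * h j j x =
      ∫ x in ball (0 : Plane) R,
        ∑ j, radialHess (tangentProfileD (ε ^ 2)) (tangentProfileDD (ε ^ 2)) j j x * w x := by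
    have i1 : ∀ j, Integrable (fun x => radialField T x * h j j x)
        (volume.restrict (ball (0 : Plane) R)) := fun j =>
      HT.memLp.integrable_mul (H.memLp_hess j j)
    have i2 : ∀ j, Integrable (fun x => radialHess (tangentProfileD (ε ^ 2))
        (tangentProfileDD (ε ^ 2)) j j x * w x) (volume.restrict (ball (0 : Plane) R)) := fun j =>
      (HT.memLp_hess j j).integrable_mul H.memLp
    rw [integral_finsetSum _ fun j _ => i1 j, integral_finsetSum _ fun j _ => i2 j]
    exact Finset.sum_congr rfl fun j _ => HT.integral_mul_hess isOpen_ball hw20 H j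
  have e3 : ∫ x in ball (0 : Plane) R,
        ∑ j, radialHess (tangentProfileD (ε ^ 2)) (tangentProfileDD (ε ^ 2)) j j x * w x =
      ∫ x in ball (0 : Plane) R, (ball (0 : Plane) ε).indicator
        (fun x => -8 / (ε ^ 2) ^ 2 * (x 0 * (c₀ + c₁ * x 0 + c₂ * x 1))) x := by
    refine integral_congr_ae ?_
    filter_upwards [ae_restrict_of_ae hwae, ae_restrict_of_ae hne] with x hx hxn
    rw [← Finset.sum_mul]
    rcases hcase x hxn with hxb | ⟨hxo, hxb⟩
    · rw [Set.indicator_of_mem hxb, laplacian_tangentProfile_inner ((hball x).2 hxb), hx hxb]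
      ring
    · rw [Set.indicator_of_notMem hxb, laplacian_tangentProfile_outer ha hxo, zero_mul]
  rw [e1, e2, e3, setIntegral_indicator measurableSet_ball, Set.inter_eq_right.2 hsub,
    integral_const_mul, setIntegral_coord_mul_affine hε.le]
  field_simp
  ring

end EulerLagrange

/-! ### The explicit minimizer -/

section Minimizer

variable (E ν s ε R : ℝ)

/-- The prefactor of the minimizer. -/
noncomputable def dipoleConst : ℝ := s / (16 * Real.pi) * (E / (1 - ν ^ 2))

variable {ε R}

theorem dipoleMinimizer_eq (hε : 0 < ε) {x : Plane} (hx : x ∈ ball (0 : Plane) R) :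
    dipoleMinimizer E ν s ε R x = radialField (dipoleProfile (dipoleConst E ν s) ε R) x := by
  have hlog : Real.log (ε ^ 2) = 2 * Real.log ε := by rw [Real.log_pow]; norm_num
  have hxR : ‖x‖ ^ 2 ≤ R ^ 2 := (normSq_mapsTo R hx).2
  rw [dipoleMinimizer, radialField, dipoleProfile, annulusProfile, dipoleConst]
  split_ifs with h
  · rw [clampSq_of_le (pow_le_pow_left₀ (norm_nonneg x) h.le 2), hlog]
    ring
  · rw [clampSq_of_mem ⟨pow_le_pow_left₀ hε.le (not_lt.1 h) 2, hxR⟩]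
    ring

/-- The slope of the minimizer in the disc. -/
noncomputable def dipoleSlope (ε R : ℝ) : ℝ :=
  dipoleConst E ν s * (4 * ((R ^ 2 - ε ^ 2) / (R ^ 2 + ε ^ 2) - Real.log (R / ε)))

theorem dipoleMinimizer_inner (hε : 0 < ε) (hεR : ε < R) :
    ∀ᵐ x : Plane ∂(volume.restrict (ball 0 ε)), dipoleMinimizer E ν s ε R x =
      0 + dipoleSlope E ν s ε R * x 0 + 0 * x 1 := by
  filter_upwards [ae_restrict_mem measurableSet_ball] with x hx
  have hR := hε.trans hεR
  have hlog : Real.log (R / ε) = Real.log R - Real.log ε := Real.log_div hR.ne' hε.ne'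
  have hlog2 : Real.log (R ^ 2) = 2 * Real.log R := by rw [Real.log_pow]; norm_num
  have hpos : 0 < R ^ 2 + ε ^ 2 := by positivity
  rw [dipoleMinimizer, if_pos (mem_ball_zero_iff.1 hx), dipoleSlope, dipoleConst, coeffAlpha,
    coeffBeta, coeffGamma, hlog, hlog2]
  field_simp
  ring

theorem hasWeakHess_dipoleMinimizer (hε : 0 < ε) (hεR : ε < R) :
    HasWeakHess (ball 0 R) (dipoleMinimizer E ν s ε R)
      (radialGrad (dipoleProfile (dipoleConst E ν s) ε R)
        (dipoleProfileD (dipoleConst E ν s) ε R))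
      (radialHess (dipoleProfileD (dipoleConst E ν s) ε R)
        (dipoleProfileDD (dipoleConst E ν s) ε R)) := by
  refine (hasWeakHess_dipoleProfile hε hεR).congr ?_
  filter_upwards [ae_restrict_mem measurableSet_ball] with x hx
  exact (dipoleMinimizer_eq E ν s hε hx).symm

theorem memH20_dipoleMinimizer (hε : 0 < ε) (hεR : ε < R) :
    MemH20 (ball 0 R) (dipoleMinimizer E ν s ε R) := by
  refine (memH20_dipoleProfile (k := dipoleConst E ν s) hε hεR).congr isOpen_ball ?_
  filter_upwards [ae_restrict_mem measurableSet_ball] with x hx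
  exact (dipoleMinimizer_eq E ν s hε hx).symm

theorem memB_dipoleMinimizer (hε : 0 < ε) (hεR : ε < R) :
    MemB ε R (dipoleMinimizer E ν s ε R) :=
  ⟨memH20_dipoleMinimizer E ν s hε hεR, 0, dipoleSlope E ν s ε R, 0,
    dipoleMinimizer_inner E ν s hε hεR⟩

variable {E ν}

/-- The bilinear form of the energy, tested with the minimizer, is minus the dipole load. -/
theorem integral_hessForm_dipoleMinimizer (hE : 0 < E) (hν₁ : -1 < ν) (hν₂ : ν < 1 / 2)
    (hε : 0 < ε) (hεR : ε < R) {w : Plane → ℝ} {g : Fin 2 → Plane → ℝ}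
    {h : Fin 2 → Fin 2 → Plane → ℝ} {c₀ c₁ c₂ : ℝ} (hw20 : MemH20 (ball 0 R) w)
    (H : HasWeakHess (ball 0 R) w g h)
    (hw : ∀ᵐ x : Plane ∂(volume.restrict (ball 0 ε)), w x = c₀ + c₁ * x 0 + c₂ * x 1) :
    (1 + ν) / E * ∫ x in ball (0 : Plane) R,
      hessForm ν (radialHess (dipoleProfileD (dipoleConst E ν s) ε R)
        (dipoleProfileDD (dipoleConst E ν s) ε R)) h x = -(s * c₁) := by
  rw [(hasWeakHess_dipoleMinimizer E ν s hε hεR).integral_hessForm ν isOpen_ball hw20 H,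
    integral_laplacian_dipole_mul hε hεR hw20 H hw, dipoleConst]
  have h1 : 1 - ν ≠ 0 := by linarith
  have h2 : 1 + ν ≠ 0 := by linarith
  have h3 : 1 - ν ^ 2 ≠ 0 := by
    rw [show 1 - ν ^ 2 = (1 - ν) * (1 + ν) by ring]; exact mul_ne_zero h1 h2
  have hπ := Real.pi_ne_zero
  field_simp
  ring

/-- Completing the square: the functional exceeds its value at the minimizer by the energy of the
difference. -/
theorem dipoleFunctional_sub (hE : 0 < E) (hν₁ : -1 < ν) (hν₂ : ν < 1 / 2)
    (hε : 0 < ε) (hεR : ε < R) {w : Plane → ℝ} {g : Fin 2 → Plane → ℝ}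
    {h : Fin 2 → Fin 2 → Plane → ℝ} (hw : MemB ε R w) (H : HasWeakHess (ball 0 R) w g h)
    {d : Fin 2 → Fin 2 → Plane → ℝ}
    (hd : d = fun i j x => h i j x - radialHess (dipoleProfileD (dipoleConst E ν s) ε R)
        (dipoleProfileDD (dipoleConst E ν s) ε R) i j x) :
    dipoleFunctional E ν s ε R w = dipoleFunctional E ν s ε R (dipoleMinimizer E ν s ε R) +
      1 / 2 * ((1 + ν) / E) * ∫ x in ball (0 : Plane) R, hessForm ν d d x := by
  subst hd
  obtain ⟨hw20, c₀, c₁, c₂, hwc⟩ := hw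
  have HW := hasWeakHess_dipoleMinimizer E ν s hε hεR
  have hWc := dipoleMinimizer_inner E ν s hε hεR
  have hdc : ∀ᵐ x : Plane ∂(volume.restrict (ball 0 ε)), w x - dipoleMinimizer E ν s ε R x =
      c₀ + (c₁ - dipoleSlope E ν s ε R) * x 0 + c₂ * x 1 := by
    filter_upwards [hwc, hWc] with x h1 h2
    rw [h1, h2]; ring
  have key := integral_hessForm_dipoleMinimizer s hE hν₁ hν₂ hε hεR
    (hw20.sub isOpen_ball (memH20_dipoleMinimizer E ν s hε hεR)) (H.sub HW) hdc
  rw [dipoleFunctional_eq hε hεR H hwc, dipoleFunctional_eq hε hεR HW hWc,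
    H.elasticEnergy_eq E ν isOpen_ball, HW.elasticEnergy_eq E ν isOpen_ball,
    integral_hessForm_expand ν H HW]
  linear_combination key

theorem dipoleFunctional_dipoleMinimizer (hE : 0 < E) (hν₁ : -1 < ν) (hν₂ : ν < 1 / 2)
    (hε : 0 < ε) (hεR : ε < R) :
    dipoleFunctional E ν s ε R (dipoleMinimizer E ν s ε R) = s / 2 * dipoleSlope E ν s ε R := by
  have HW := hasWeakHess_dipoleMinimizer E ν s hε hεR
  have hWc := dipoleMinimizer_inner E ν s hε hεR
  have key := integral_hessForm_dipoleMinimizer s hE hν₁ hν₂ hε hεR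
    (memH20_dipoleMinimizer E ν s hε hεR) HW hWc
  rw [dipoleFunctional_eq hε hεR HW hWc, HW.elasticEnergy_eq E ν isOpen_ball]
  linear_combination (1 / 2) * key

end Minimizer

end AiryDipole

theorem lemma3p6 (E ν : ℝ) (hE : 0 < E) (hν₁ : -1 < ν) (hν₂ : ν < 1 / 2)
    (s : ℝ) (hs : s ≠ 0) (ε R : ℝ) (hε : 0 < ε) (hεR : ε < R) :
    AiryDipole.MemB ε R (AiryDipole.dipoleMinimizer E ν s ε R) ∧
    (∀ w, AiryDipole.MemB ε R w →
      AiryDipole.dipoleFunctional E ν s ε R (AiryDipole.dipoleMinimizer E ν s ε R) ≤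
        AiryDipole.dipoleFunctional E ν s ε R w) ∧
    (∀ v, AiryDipole.MemB ε R v →
      (∀ w, AiryDipole.MemB ε R w →
        AiryDipole.dipoleFunctional E ν s ε R v ≤ AiryDipole.dipoleFunctional E ν s ε R w) →
      v =ᵐ[volume.restrict (ball 0 R)] AiryDipole.dipoleMinimizer E ν s ε R) ∧
    AiryDipole.dipoleFunctional E ν s ε R (AiryDipole.dipoleMinimizer E ν s ε R) =
      -(s ^ 2 / (8 * Real.pi)) * (E / (1 - ν ^ 2)) *
        (Real.log (R / ε) - (R ^ 2 - ε ^ 2) / (R ^ 2 + ε ^ 2)) := by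
  open AiryDipole in
  have hA : 0 < 1 / 2 * ((1 + ν) / E) := by
    have : 0 < 1 + ν := by linarith
    positivity
  have hm : 0 < min 1 (1 - 2 * ν) := lt_min one_pos (by linarith)
  have hnn : ∀ (d : Fin 2 → Fin 2 → Plane → ℝ) (x : Plane), 0 ≤ hessForm ν d d x := fun d x =>
    (by positivity : 0 ≤ min 1 (1 - 2 * ν) * d 0 0 x ^ 2).trans (le_hessForm_self hν₂ d x)
  have HW := hasWeakHess_dipoleMinimizer E ν s hε hεR
  have hWB := memB_dipoleMinimizer E ν s hε hεR
  refine ⟨hWB, fun w hw => ?_, fun v hv hmin => ?_, ?_⟩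
  · rw [dipoleFunctional_sub s hE hν₁ hν₂ hε hεR hw (hw.1.1.hasWeakHess isOpen_ball) rfl]
    exact le_add_of_nonneg_right (mul_nonneg hA.le (integral_nonneg fun x => hnn _ x))
  · have Hv := hv.1.1.hasWeakHess isOpen_ball
    have Hd := Hv.sub HW
    have hle := hmin _ hWB
    obtain ⟨d, hd⟩ : ∃ d : Fin 2 → Fin 2 → Plane → ℝ, d = fun i j x =>
        weakHess (ball 0 R) i j v x - radialHess (dipoleProfileD (dipoleConst E ν s) ε R)
          (dipoleProfileDD (dipoleConst E ν s) ε R) i j x := ⟨_, rfl⟩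
    rw [← hd] at Hd
    rw [dipoleFunctional_sub s hE hν₁ hν₂ hε hεR hv Hv hd] at hle
    have hint : 0 ≤ ∫ x in ball (0 : Plane) R, hessForm ν d d x :=
      integral_nonneg fun x => hnn d x
    have hz := le_antisymm (nonpos_of_mul_nonpos_right (by linarith) hA) hint
    rw [integral_eq_zero_iff_of_nonneg (fun x => hnn d x) (Hd.integrable_hessForm ν Hd)] at hz
    have hu := (hv.1.sub isOpen_ball hWB.1).ae_eq_zero (hε.trans hεR) Hd (by
      filter_upwards [hz] with x hx
      have h1 := (le_hessForm_self hν₂ d x).trans_eq hx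
      exact (pow_eq_zero_iff two_ne_zero).1
        (le_antisymm (nonpos_of_mul_nonpos_right h1 hm) (sq_nonneg _)))
    filter_upwards [hu] with x hx
    exact sub_eq_zero.1 hx
  · rw [dipoleFunctional_dipoleMinimizer s hE hν₁ hν₂ hε hεR, dipoleSlope, dipoleConst]
    ring
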